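/- Let $k$ be a field of characteristic zero, $N$ a free $\mathbb{Z}$-module of finite rank $d$, $M=\mathrm{Hom}_{\mathbb Z}(N,\mathbb Z)$, and $\sigma$ a strongly convex rational polyhedral cone in $N_{\mathbb R}$. Let $\{m_1,\dots,m_h\}$ be a minimal set of generators of the monoid $S_\sigma=\sigma^\vee\cap M$, numbered so that $\{m_1,\dots,m_d\}$ is a $\mathbb Z$-basis of $M$ (we assume that this is possible). Present the affine toric variety $V_\sigma=\mathrm{Spec}\,k[S_\sigma]$ as a closed subscheme of $\mathbb A^h_k=\mathrm{Spec}\,k[Z_1,\dots,Z_h]$ through $Z_i\mapsto\chi^{m_i}$. For $\ell\in\mathbb Z^h$ put $F_\ell=\prod_{\ell_i\ge 0}Z_i^{\ell_i}-\prod_{\ell_i<0}Z_i^{-\ell_i}$. For $d+1\le q\le h$ let $\ell_q\in\mathbb Z^h$ be the unique vector with $\sum_i\ell_{q,i}m_i=0$, $\ell_{q,q}=1$ and $\ell_{q,q'}=0$ for $q'\in\{d+1,\dots,h\}\setminus\{q\}$, and put $F_q=F_{\ell_q}$. Let $W=\mathrm{Spec}\big(k[Z_1,\dots,Z_h]/\langle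 F_q: d+1\le q\le h\rangle\big)$; it contains $V_\sigma$ as a closed subscheme. For $F\in k[Z_1,\dots,Z_h]$ define $F_s\in k[Z_{i,s}:1\le i\le h,\ s\in\mathbb N]$ by $F|_{Z_i=\sum_s Z_{i,s}t^s}=\sum_{s}F_st^s$. The arc scheme of $\mathrm{Spec}(k[Z_1,\dots,Z_h]/I)$ is $\mathrm{Spec}\big(k[Z_{i,s}]/\langle F_s: F\in I, s\in\mathbb N\rangle\big)$. Let $n\in\sigma\cap N$. The Nash set of the toric valuation $\mathrm{ord}_n(f)=\inf_{\chi^m\in f}\langle n,m\rangle$ is the closure in $\mathrm{Arc}(V_\sigma)$ of the set of the arcs $\alpha$ such that $\mathrm{ord}_t(\alpha^*(f))=\mathrm{ord}_n(f)$ for every $f\in k[S_\sigma]$. It has a (unique) generic point $\eta_n$; let $\eta'_n$ be the image of $\eta_n$ under the closed immersion $\mathrm{Arc}(V_\sigma)\to\mathrm{Arc}(W)$. Let $\mathcal W(n,\{\ell_q\})$ be the formal completion along the origin of the closed subscheme of $\mathrm{Spec}\,k[Z_{i,s}:1\le i\le h,\ 0\le s<\langle n,m_i\rangle]$ defined by all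 the coefficients of the powers of $t$ in the polynomials $$F_q\Big|_{Z_i=t^{\langle n,m_i\rangle}+\sum_{0\le s<\langle n,m_i\rangle}Z_{i,s}t^s},\qquad d+1\le q\le h.$$ Let $K=k(Z_{i,s}:1\le i\le d,\ s\ge\langle n,m_i\rangle)$. Then there is a morphism of $k$-algebras $K\to\mathcal O_{\mathrm{Arc}(W),\eta'_n}$ sending each $Z_{i,s}$ to the class of $Z_{i,s}$, and its composition with the projection onto the residue field of $\eta'_n$ is an isomorphism. For the resulting structure of formal $K$-scheme on the formal neighborhood $\mathrm{Spf}\,\widehat{\mathcal O_{\mathrm{Arc}(W),\eta'_n}}$ of $\mathrm{Arc}(W)$ at $\eta'_n$, this formal neighborhood is isomorphic, as a formal $K$-scheme, to $K\,\widehat\otimes_k\,\mathcal W(n,\{\ell_q\})$. -/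

import Mathlib

open scoped TensorProduct

noncomputable section

namespace ToricArc

universe u v w

/-! ### Cones, dual monoids and presentations of affine toric varieties -/

section Cones

variable {N : Type v} [AddCommGroup N]

/-- The pairing `⟨m, ·⟩ : N_ℝ → ℝ` of a character `m ∈ M = Hom(N, ℤ)` with `N_ℝ = ℝ ⊗ N`. -/
def realPairing (m : Module.Dual ℤ N) : (ℝ ⊗[ℤ] N) →ₗ[ℝ] ℝ :=
  Module.Dual.baseChange ℝ m

theorem realPairing_tmul (m : Module.Dual ℤ N) (r : ℝ) (x : N) :
    realPairing m (r ⊗ₜ[ℤ] x) = (m x : ℝ) * r := by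
  simp [realPairing]

theorem realPairing_zero : realPairing (0 : Module.Dual ℤ N) = 0 := by
  simp [realPairing]

theorem realPairing_add (m m' : Module.Dual ℤ N) :
    realPairing (m + m') = realPairing m + realPairing m' := by
  simp [realPairing]

/-- The monoid `S_σ = σ^∨ ∩ M`. -/
def dualMonoid (σ : PointedCone ℝ (ℝ ⊗[ℤ] N)) : AddSubmonoid (Module.Dual ℤ N) where
  carrier := {m | ∀ x ∈ σ, 0 ≤ realPairing m x}
  zero_mem' := fun x _ => by simp [realPairing_zero]
  add_mem' := fun {a b} ha hb x hx => by
    rw [realPairing_add]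
    exact add_nonneg (ha x hx) (hb x hx)

end Cones

/-- A strongly convex rational polyhedral cone `σ` in `N_ℝ`, together with a minimal set of
generators `m_1, …, m_h` of the monoid `S_σ`, numbered in such a way that `m_1, …, m_d` is a
`ℤ`-basis of `M = Hom(N, ℤ)`. The index set `{1, …, h}` is written `Fin d ⊕ Fin c` with
`h = d + c`: the indices `i ≤ d` are the `inl i`, and the indices `q ∈ {d+1, …, h}` are the
`inr q`. -/
structure AffineToricData (N : Type v) [AddCommGroup N] (d c : ℕ) where
  /-- the cone `σ` -/
  cone : PointedCone ℝ (ℝ ⊗[ℤ] N)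
  /-- `σ` is generated by finitely many elements of `N` -/
  rational_polyhedral : ∃ s : Finset N,
    cone = PointedCone.hull ℝ ((fun x : N => (1 : ℝ) ⊗ₜ[ℤ] x) '' (s : Set N))
  /-- `σ` contains no line -/
  strongly_convex : ∀ x ∈ cone, -x ∈ cone → x = 0
  /-- the generators `m_1, …, m_h` -/
  gen : Fin d ⊕ Fin c → Module.Dual ℤ N
  /-- they generate the monoid `S_σ` -/
  closure_range_gen : AddSubmonoid.closure (Set.range gen) = dualMonoid cone
  /-- none of them can be omitted -/
  minimal : ∀ i, gen i ∉ AddSubmonoid.closure (gen '' {i}ᶜ)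
  /-- `m_1, …, m_d` are linearly independent over `ℤ` -/
  linearIndependent : LinearIndependent ℤ (fun i : Fin d => gen (Sum.inl i))
  /-- `m_1, …, m_d` span `M` -/
  span_eq_top : Submodule.span ℤ (Set.range fun i : Fin d => gen (Sum.inl i)) = ⊤

/-! ### Arc schemes of closed subschemes of affine space -/

section Arcs

variable {k : Type u} [Field k] {ι : Type w}

/-- The morphism of `k`-algebras `HS : k[Z] → k[Z_∞]⟦t⟧`, `Z_i ↦ ∑_s Z_{i,s} t^s`, where
`k[Z_∞] = k[Z_{i,s} : i ∈ ι, s ∈ ℕ]`. -/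
def HS : MvPolynomial ι k →ₐ[k] PowerSeries (MvPolynomial (ι × ℕ) k) :=
  MvPolynomial.aeval fun i => PowerSeries.mk fun s => MvPolynomial.X (i, s)

/-- The coefficient `F_s` of `t^s` in `HS(F)`. -/
def hsCoeff (F : MvPolynomial ι k) (s : ℕ) : MvPolynomial (ι × ℕ) k :=
  PowerSeries.coeff s (HS F)

/-- The ideal `[I]` of `k[Z_∞]` generated by the `F_s` for `F ∈ I` and `s ∈ ℕ`. -/
def arcIdeal (I : Ideal (MvPolynomial ι k)) : Ideal (MvPolynomial (ι × ℕ) k) :=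
  Ideal.span {P | ∃ F ∈ I, ∃ s : ℕ, P = hsCoeff F s}

theorem arcIdeal_mono {I J : Ideal (MvPolynomial ι k)} (h : I ≤ J) :
    arcIdeal I ≤ arcIdeal J :=
  Ideal.span_mono fun _ ⟨F, hF, s, hs⟩ => ⟨F, h hF, s, hs⟩

/-- The coordinate ring `k[Z_∞]/[I]` of the arc scheme of `Spec (k[Z]/I)`. -/
abbrev ArcRing (I : Ideal (MvPolynomial ι k)) : Type (max u w) :=
  MvPolynomial (ι × ℕ) k ⧸ arcIdeal I

/-- The universal arc `k[Z]/I → (k[Z_∞]/[I])⟦t⟧` on `Spec (k[Z]/I)`. -/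
def universalArc (I : Ideal (MvPolynomial ι k)) :
    (MvPolynomial ι k ⧸ I) →+* PowerSeries (ArcRing I) :=
  Ideal.Quotient.lift I
    ((PowerSeries.map (Ideal.Quotient.mk (arcIdeal I))).comp (HS (k := k) (ι := ι)).toRingHom)
    (fun F hF => by
      ext s
      have h : hsCoeff F s ∈ arcIdeal I := Ideal.subset_span ⟨F, hF, s, rfl⟩
      simpa [hsCoeff] using Ideal.Quotient.eq_zero_iff_mem.mpr h)

/-- The semivaluation `ord_α` on `k[Z]/I` defined by a point `α` of the arc scheme: the order in
`t` of the image of a function in `κ(α)⟦t⟧`. -/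
def arcOrd {I : Ideal (MvPolynomial ι k)} (α : PrimeSpectrum (ArcRing I))
    (f : MvPolynomial ι k ⧸ I) : ℕ∞ :=
  (PowerSeries.map (algebraMap (ArcRing I) α.asIdeal.ResidueField) (universalArc I f)).order

/-- For `I ≤ J`, the ring morphism dual to the closed immersion of the arc scheme of
`Spec (k[Z]/J)` into the arc scheme of `Spec (k[Z]/I)`. -/
def arcRestrict {I J : Ideal (MvPolynomial ι k)} (h : I ≤ J) : ArcRing I →+* ArcRing J :=
  Ideal.Quotient.factor (arcIdeal_mono h)

/-- The binomial `F_ℓ = Z^{ℓ⁺} - Z^{ℓ⁻}` attached to `ℓ ∈ ℤ^ι`. -/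
def binomial (k : Type u) [Field k] [Fintype ι] (ℓ : ι → ℤ) : MvPolynomial ι k :=
  ∏ i, MvPolynomial.X i ^ (ℓ i).toNat - ∏ i, MvPolynomial.X i ^ (-ℓ i).toNat

end Arcs

/-! ### Affine formal schemes -/

/-- The inverse limit topology on the completion `lim_e R/I^e` (each `R/I^e` being discrete). -/
@[reducible] def limitTopology {R : Type u} [CommRing R] (I : Ideal R) :
    TopologicalSpace (AdicCompletion I R) :=
  ⨅ e : ℕ, TopologicalSpace.induced (AdicCompletion.evalₐ I e) ⊥

/-- Let `K` be a ring, `R` and `S` two `K`-algebras with structure morphisms `φ` and `ψ`, `I` an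
ideal of `R` and `J` an ideal of `S`. The affine formal schemes `Spf (lim_e R/I^e)` and
`Spf (lim_e S/J^e)` are isomorphic as formal `K`-schemes: there is an isomorphism of topological
`K`-algebras between their rings of sections. -/
def FormalIsoOver {K : Type u} {R : Type v} {S : Type w} [CommRing K] [CommRing R] [CommRing S]
    (φ : K →+* R) (I : Ideal R) (ψ : K →+* S) (J : Ideal S) : Prop :=
  ∃ e : AdicCompletion I R ≃+* AdicCompletion J S,
    (∀ a : K, e (algebraMap R (AdicCompletion I R) (φ a)) =
      algebraMap S (AdicCompletion J S) (ψ a)) ∧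
    @IsHomeomorph _ _ (limitTopology I) (limitTopology J) e

/-! ### The toric variety, the complete intersection, and the formal model -/

namespace AffineToricData

variable {N : Type v} [AddCommGroup N] {d c : ℕ} (D : AffineToricData N d c)

theorem gen_mem (i : Fin d ⊕ Fin c) : D.gen i ∈ dualMonoid D.cone :=
  D.closure_range_gen ▸ AddSubmonoid.subset_closure (Set.mem_range_self i)

/-- The basis `m_1, …, m_d` of `M`. -/
def basis : Module.Basis (Fin d) ℤ (Module.Dual ℤ N) :=
  Module.Basis.mk D.linearIndependent D.span_eq_top.ge

/-- The integer `⟨n, m_i⟩`, as a natural number (it is nonnegative for `n ∈ σ ∩ N`). -/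
def height (n : N) (i : Fin d ⊕ Fin c) : ℕ := (D.gen i n).toNat

/-- The presentation `k[Z_1, …, Z_h] → k[S_σ]`, `Z_i ↦ χ^{m_i}`, of the coordinate ring of the
toric variety `V_σ`. -/
def toricMap (k : Type u) [Field k] :
    MvPolynomial (Fin d ⊕ Fin c) k →ₐ[k] AddMonoidAlgebra k (dualMonoid D.cone) :=
  MvPolynomial.aeval fun i => AddMonoidAlgebra.single ⟨D.gen i, D.gen_mem i⟩ 1

/-- The ideal of `V_σ` in `k[Z_1, …, Z_h]`. -/
def toricIdeal (k : Type u) [Field k] : Ideal (MvPolynomial (Fin d ⊕ Fin c) k) :=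
  RingHom.ker (D.toricMap k)

/-- The toric valuation `ord_n(f) = inf_{χ^m ∈ f} ⟨m, n⟩` on `k[S_σ]`, for `n ∈ σ ∩ N`
(with value `⊤` at `f = 0`). -/
def toricOrd {k : Type u} [Field k] (n : N) (f : AddMonoidAlgebra k (dualMonoid D.cone)) : ℕ∞ :=
  ⨅ m ∈ f.coeff.support, (((m : Module.Dual ℤ N) n).toNat : ℕ∞)

/-- The Nash set of `ord_n`: the closure in the arc scheme of `V_σ` of the set of the arcs `α`
with `ord_α = ord_n`. -/
def nashSet (k : Type u) [Field k] (n : N) : Set (PrimeSpectrum (ArcRing (D.toricIdeal k))) :=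
  closure {α | ∀ F : MvPolynomial (Fin d ⊕ Fin c) k,
    arcOrd α (Ideal.Quotient.mk (D.toricIdeal k) F) = D.toricOrd n (D.toricMap k F)}

/-- The vector `ℓ_q ∈ L ⊆ ℤ^h`, `q ∈ {d+1, …, h}`: its `q`-th coordinate is `1`, the other
coordinates of index `> d` vanish, and `∑ i, ℓ_{q,i} m_i = 0`. -/
def ell (q : Fin c) : Fin d ⊕ Fin c → ℤ :=
  Sum.elim (fun i => -(D.basis.repr (D.gen (Sum.inr q)) i)) (Pi.single q 1)

theorem sum_ell (q : Fin c) : ∑ i, D.ell q i • D.gen i = 0 := by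
  have h := D.basis.sum_repr (D.gen (Sum.inr q))
  have hb : ∀ i, D.basis i = D.gen (Sum.inl i) := fun i => by simp [basis]
  simp only [hb] at h
  rw [Fintype.sum_sum_type]
  simp only [ell, Sum.elim_inl, Sum.elim_inr, neg_smul, Finset.sum_neg_distrib, h]
  rw [Finset.sum_eq_single q]
  · simp
  · intro b _ hbq
    simp [Pi.single_eq_of_ne hbq]
  · simp

/-- The ideal `𝔧 = ⟨F_q : d+1 ≤ q ≤ h⟩` of the complete intersection `W`, where
`F_q = F_{ℓ_q}`. -/
def ciIdeal (k : Type u) [Field k] : Ideal (MvPolynomial (Fin d ⊕ Fin c) k) :=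
  Ideal.span (Set.range fun q : Fin c => binomial k (D.ell q))

theorem ciIdeal_le_toricIdeal (k : Type u) [Field k] : D.ciIdeal k ≤ D.toricIdeal k := by
  refine Ideal.span_le.mpr ?_
  rintro _ ⟨q, rfl⟩
  have key : ∀ e : Fin d ⊕ Fin c → ℕ,
      D.toricMap k (∏ i, MvPolynomial.X i ^ e i) =
        AddMonoidAlgebra.single (∑ i, e i • (⟨D.gen i, D.gen_mem i⟩ : dualMonoid D.cone)) 1 := by
    intro e
    rw [map_prod]
    simp only [map_pow, toricMap, MvPolynomial.aeval_X, AddMonoidAlgebra.single_pow, one_pow]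
    rw [AddMonoidAlgebra.prod_single]
    simp
  have hsum : ∑ i, (D.ell q i).toNat • (⟨D.gen i, D.gen_mem i⟩ : dualMonoid D.cone) =
      ∑ i, (-D.ell q i).toNat • (⟨D.gen i, D.gen_mem i⟩ : dualMonoid D.cone) := by
    apply Subtype.ext
    simp only [AddSubmonoid.coe_finsetSum, AddSubmonoidClass.coe_nsmul]
    rw [← sub_eq_zero, ← Finset.sum_sub_distrib, ← D.sum_ell q]
    refine Finset.sum_congr rfl fun i _ => ?_
    rw [← natCast_zsmul, ← natCast_zsmul, ← sub_smul, Int.toNat_sub_toNat_neg]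
  show D.toricMap k (binomial k (D.ell q)) = 0
  rw [binomial, map_sub, key, key, hsum, sub_self]

/-- The image in the arc scheme of `W` of a point of the arc scheme of `V_σ`. -/
def toCI (k : Type u) [Field k] (η : PrimeSpectrum (ArcRing (D.toricIdeal k))) :
    PrimeSpectrum (ArcRing (D.ciIdeal k)) :=
  PrimeSpectrum.comap (arcRestrict (D.ciIdeal_le_toricIdeal k)) η

/-- The variables `Z_{i,s}`, `i ≤ d`, `s ≥ ⟨n, m_i⟩`. -/
abbrev BaseVars (n : N) : Type :=
  {p : Fin d × ℕ // D.height n (Sum.inl p.1) ≤ p.2}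

/-- The field `K = k(Z_{i,s} : i ≤ d, s ≥ ⟨n, m_i⟩)`. -/
abbrev BaseField (k : Type u) [Field k] (n : N) : Type u :=
  FractionRing (MvPolynomial (D.BaseVars n) k)

/-- The variables `Z_{i,s}`, `1 ≤ i ≤ h`, `0 ≤ s < ⟨n, m_i⟩`. -/
abbrev ModelVars (n : N) : Type :=
  {p : (Fin d ⊕ Fin c) × ℕ // p.2 < D.height n p.1}

/-- The morphism sending `Z_{i,s}` to itself for `s < ⟨n, m_i⟩`, to `1` for `s = ⟨n, m_i⟩` and to
`0` for `s > ⟨n, m_i⟩`. -/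
def truncate (k : Type u) [Field k] (n : N) :
    MvPolynomial ((Fin d ⊕ Fin c) × ℕ) k →ₐ[k] MvPolynomial (D.ModelVars n) k :=
  MvPolynomial.aeval fun p =>
    if h : p.2 < D.height n p.1 then MvPolynomial.X ⟨p, h⟩
    else if p.2 = D.height n p.1 then 1 else 0

/-- The ideal of the closed subscheme `W(n, L')` of `Spec k[Z_{i,s} : s < ⟨n, m_i⟩]`. -/
def modelIdeal (k : Type u) [Field k] (n : N) (L' : Set (Fin d ⊕ Fin c → ℤ)) :
    Ideal (MvPolynomial (D.ModelVars n) k) :=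
  Ideal.span {P | ∃ ℓ ∈ L', ∃ s : ℕ, P = D.truncate k n (hsCoeff (binomial k ℓ) s)}

/-- The coordinate ring of `W(n, L')`. -/
abbrev ModelRing (k : Type u) [Field k] (n : N) (L' : Set (Fin d ⊕ Fin c → ℤ)) : Type u :=
  MvPolynomial (D.ModelVars n) k ⧸ D.modelIdeal k n L'

/-- The ideal of the origin in the coordinate ring of `W(n, L')`. -/
def modelOrigin (k : Type u) [Field k] (n : N) (L' : Set (Fin d ⊕ Fin c → ℤ)) :
    Ideal (D.ModelRing k n L') :=
  (Ideal.span (Set.range MvPolynomial.X)).map (Ideal.Quotient.mk (D.modelIdeal k n L'))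

/-- The ring of sections of the formal scheme `𝒲(n, L')`, the formal completion of `W(n, L')`
along the origin. -/
abbrev FormalModel (k : Type u) [Field k] (n : N) (L' : Set (Fin d ⊕ Fin c → ℤ)) : Type u :=
  AdicCompletion (D.modelOrigin k n L') (D.ModelRing k n L')

/-- The extension to `K ⊗_k 𝒪(𝒲(n, L'))` of the ideal of definition of `𝒲(n, L')`. The completion
of `K ⊗_k 𝒪(𝒲(n, L'))` with respect to it is the ring of sections of `K ⊗̂_k 𝒲(n, L')`. -/
def baseChangeIdeal (k : Type u) [Field k] (n : N) (L' : Set (Fin d ⊕ Fin c → ℤ))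
    (K : Type u) [Field K] [Algebra k K] : Ideal (K ⊗[k] D.FormalModel k n L') :=
  ((D.modelOrigin k n L').map
    (algebraMap (D.ModelRing k n L') (D.FormalModel k n L'))).map
      (Algebra.TensorProduct.includeRight :
        D.FormalModel k n L' →ₐ[k] K ⊗[k] D.FormalModel k n L')

end AffineToricData

end ToricArc

end

/-! The formal neighborhood is determined by the morphisms from the local ring to `k`-algebras `B`
with a nilpotent ideal `I`: these are the `B`-arcs on `W` that reduce to the generic arc modulo `I`.
The structure of `K`-algebra fixes their coordinates `Z_{i,s}` for `i ≤ d` and `s ≥ ⟨n, m_i⟩`. The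
proof identifies these deformations with the points of the model with coordinates in `I`.

Along the generic arc, `Z_i` is `t^⟨n, m_i⟩` times a unit. Weierstrass preparation over `B`
(`exists_isDistinguished_mul_unit`) writes each deformed coordinate uniquely as `P_i u_i`, with
`P_i` monic of degree `⟨n, m_i⟩`, congruent to `t^⟨n, m_i⟩` modulo `I`, and `u_i` a unit. The
relation `∑ ℓ_{q,i} m_i = 0`, evaluated at `n`, says that the two monomials of `F_q` give
distinguished polynomials of the same degree. By uniqueness, the equation `F_q = 0` splits into one
for the `P_i` and one for the `u_i`. The first is an equation of the model. Since `ℓ_{q,q} = 1`, the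
second expresses `u_q` through `u_1, …, u_d`. Finally, once `P_i` is known, the prescribed high
coefficients of `P_i u_i` determine `u_i` for `i ≤ d`, because `u ↦ shift (P_i u)` is bijective. The
two directions are `IsArcDeformation.exists_isFactorization` and `exists_isArcDeformation`; a Yoneda
argument turns them into compatible isomorphisms modulo all powers of the ideals
(`exists_truncation_equiv`), hence into an isomorphism of formal schemes.

The generic point of the Nash set is made explicit by the toric arcs `Z_i = t^⟨n, m_i⟩ τ^{m_i}`,
where `τ` is a `d`-tuple of invertible power series. Taking independent variables as coefficients of
`τ` gives an arc with values in `K` whose semivaluation is `ord_n`, and which specializes to every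
arc with the same orders on the coordinates. -/

noncomputable section

namespace ToricArc

universe u

/-! ### Weierstrass preparation over a ring with a nilpotent ideal -/

section Weierstrass

open PowerSeries

variable {B : Type*} [CommRing B] {I : Ideal B}

/-- Division of a power series by `X ^ h`, forgetting the terms of degree less than `h`. -/
def shift (h : ℕ) : B⟦X⟧ →ₗ[B] B⟦X⟧ where
  toFun f := PowerSeries.mk fun s => coeff (s + h) f
  map_add' f g := by ext; simp
  map_smul' a f := by ext; simp

@[simp]
theorem coeff_shift (h s : ℕ) (f : B⟦X⟧) : coeff s (shift h f) = coeff (s + h) f := by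
  simp [shift]

@[simp]
theorem shift_X_pow_mul (h : ℕ) (f : B⟦X⟧) : shift h (X ^ h * f) = f := by
  ext s
  simp [coeff_X_pow_mul]

theorem map_shift {C : Type*} [CommRing C] (ψ : B →+* C) (h : ℕ) (f : B⟦X⟧) :
    PowerSeries.map ψ (shift h f) = shift h (PowerSeries.map ψ f) := by
  ext s
  simp

theorem isUnit_of_sub_mem (hI : IsNilpotent I) {a b : B} (hb : IsUnit b) (h : a - b ∈ I) :
    IsUnit a := by
  rw [← IsNilpotent.isUnit_quotient_mk_iff hI] at hb ⊢
  rwa [Ideal.Quotient.eq.mpr h]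

/-- The coefficients of `shift h (p * q)` determine `q` when `p ≡ X ^ h` modulo a nilpotent
ideal. -/
theorem bijective_shift_mul (hI : IsNilpotent I) (h : ℕ) {p : B⟦X⟧}
    (hp : ∀ s, coeff s p ∈ I) :
    Function.Bijective fun q : B⟦X⟧ => shift h ((X ^ h + p) * q) := by
  obtain ⟨e, he⟩ := hI
  -- The map is `1 + T`, and `T ^ e` sends every series into those with coefficients in `I ^ e`. So
  -- `T` is nilpotent and `1 + T` is invertible.
  set T : Module.End B B⟦X⟧ := shift h ∘ₗ LinearMap.mulLeft B p with hT
  have hTe : ∀ e q s, coeff s ((T ^ e) q) ∈ I ^ e := by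
    intro e
    induction e with
    | zero => simp
    | succ e ih =>
      intro q s
      rw [pow_succ', pow_succ', Module.End.mul_apply, hT, LinearMap.comp_apply, coeff_shift,
        LinearMap.mulLeft_apply]
      exact coeff_mul_mem_ideal_mul_ideal_of_coeff_mem_ideal' hp (ih q) _
  have hnil : IsNilpotent T := ⟨e, by
    ext q s
    simpa [he] using hTe e q s⟩
  have h1 := (Module.End.isUnit_iff _).mp hnil.isUnit_one_add
  convert h1 using 2 with q
  simp [hT, add_mul]

/-- A distinguished polynomial of degree `h`, seen as a power series. -/
structure IsDistinguished (I : Ideal B) (h : ℕ) (p : B⟦X⟧) : Prop where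
  coeff_eq : coeff h p = 1
  coeff_gt : ∀ s, h < s → coeff s p = 0
  coeff_lt : ∀ s, s < h → coeff s p ∈ I

namespace IsDistinguished

theorem shift_eq {h : ℕ} {p : B⟦X⟧} (hp : IsDistinguished I h p) : shift h p = 1 := by
  ext s
  rcases Nat.eq_zero_or_pos s with rfl | hs
  · simp [hp.coeff_eq]
  · simp [hp.coeff_gt (s + h) (by omega), coeff_one, hs.ne']

theorem coeff_sub_mem {h : ℕ} {p : B⟦X⟧} (hp : IsDistinguished I h p) (s : ℕ) :
    coeff s (p - X ^ h) ∈ I := by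
  rcases lt_trichotomy s h with hs | rfl | hs
  · simpa [coeff_X_pow, hs.ne] using hp.coeff_lt s hs
  · simp [hp.coeff_eq]
  · simp [hp.coeff_gt s hs, coeff_X_pow, hs.ne']

theorem bijective (hI : IsNilpotent I) {h : ℕ} {p : B⟦X⟧} (hp : IsDistinguished I h p) :
    Function.Bijective fun q : B⟦X⟧ => shift h (p * q) := by
  simpa using bijective_shift_mul hI h hp.coeff_sub_mem

/-- Modulo `I` the operator `q ↦ shift h (p * q)` is the identity. This shows that a solution of
`shift h (p * q) = g` is a unit when `g` is. -/
theorem coeff_shift_mul_sub_mem {h : ℕ} {p : B⟦X⟧} (hp : IsDistinguished I h p)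
    (q : B⟦X⟧) (s : ℕ) : coeff s (q - shift h (p * q)) ∈ I := by
  have : q - shift h (p * q) = - shift h ((p - X ^ h) * q) := by
    rw [sub_mul, map_sub, shift_X_pow_mul]
    ring
  rw [this, map_neg, coeff_shift]
  exact neg_mem (coeff_mul_mem_ideal_of_coeff_left_mem_ideal' hp.coeff_sub_mem _)

theorem one : IsDistinguished I 0 (1 : B⟦X⟧) :=
  ⟨by simp, fun s hs => by simp [coeff_one, hs.ne'], fun s hs => absurd hs (Nat.not_lt_zero s)⟩

theorem mul {h h' : ℕ} {p p' : B⟦X⟧} (hp : IsDistinguished I h p)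
    (hp' : IsDistinguished I h' p') : IsDistinguished I (h + h') (p * p') where
  coeff_eq := by
    rw [coeff_mul, Finset.sum_eq_single (h, h'), hp.coeff_eq, hp'.coeff_eq, mul_one]
    · rintro ⟨i, j⟩ hij hne
      rw [Finset.HasAntidiagonal.mem_antidiagonal] at hij
      rcases lt_trichotomy i h with hi | rfl | hi
      · simp [hp'.coeff_gt j (by simp at hij; omega)]
      · exact absurd (by simp at hij; simp [hij]) hne
      · simp [hp.coeff_gt i hi]
    · intro hn
      simp at hn
  coeff_gt s hs := by
    rw [coeff_mul]
    refine Finset.sum_eq_zero fun ⟨i, j⟩ hij => ?_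
    rw [Finset.HasAntidiagonal.mem_antidiagonal] at hij
    rcases lt_or_ge h i with hi | hi
    · simp [hp.coeff_gt i hi]
    · simp [hp'.coeff_gt j (by simp at hij; omega)]
  coeff_lt s hs := by
    rw [coeff_mul]
    refine sum_mem fun ⟨i, j⟩ hij => ?_
    rw [Finset.HasAntidiagonal.mem_antidiagonal] at hij
    rcases lt_or_ge i h with hi | hi
    · exact Ideal.mul_mem_right _ _ (hp.coeff_lt i hi)
    · exact Ideal.mul_mem_left _ _ (hp'.coeff_lt j (by simp at hij; omega))

theorem pow {h : ℕ} {p : B⟦X⟧} (hp : IsDistinguished I h p) (a : ℕ) :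
    IsDistinguished I (a * h) (p ^ a) := by
  induction a with
  | zero => simpa using one
  | succ a ih =>
    rw [pow_succ, add_mul, one_mul]
    exact ih.mul hp

theorem prod {κ : Type*} (S : Finset κ) {h : κ → ℕ} {p : κ → B⟦X⟧}
    (hp : ∀ i, IsDistinguished I (h i) (p i)) :
    IsDistinguished I (∑ i ∈ S, h i) (∏ i ∈ S, p i) := by
  classical
  induction S using Finset.induction_on with
  | empty => simpa using one
  | insert i S hi ih =>
    rw [Finset.sum_insert hi, Finset.prod_insert hi]
    exact (hp i).mul ih

theorem map {C : Type*} [CommRing C] {J : Ideal C} (ψ : B →+* C) (hψ : I ≤ J.comap ψ)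
    {h : ℕ} {p : B⟦X⟧} (hp : IsDistinguished I h p) :
    IsDistinguished J h (PowerSeries.map ψ p) where
  coeff_eq := by simp [hp.coeff_eq]
  coeff_gt s hs := by simp [hp.coeff_gt s hs]
  coeff_lt s hs := by simpa using hψ (hp.coeff_lt s hs)

/-- The series `u * u'⁻¹` and `1` have the same image under the injective operator `q ↦ shift h (p *
q)`, since both `p` and `p'` have shift `1`. -/
theorem unique (hI : IsNilpotent I) {h : ℕ} {p p' : B⟦X⟧} {u u' : B⟦X⟧ˣ}
    (hp : IsDistinguished I h p) (hp' : IsDistinguished I h p') (he : p * u = p' * u') :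
    p = p' ∧ u = u' := by
  have h1 : p * ↑(u * u'⁻¹) = p' := by
    rw [Units.val_mul, ← mul_assoc, he, mul_assoc, ← Units.val_mul, mul_inv_cancel,
      Units.val_one, mul_one]
  have h2 : (↑(u * u'⁻¹) : B⟦X⟧) = 1 := (hp.bijective hI).injective (by
    simp only [h1, mul_one, hp.shift_eq, hp'.shift_eq])
  have h3 : u * u'⁻¹ = 1 := Units.ext h2
  exact ⟨by simpa [h2] using h1, mul_inv_eq_one.mp h3⟩

end IsDistinguished

/-- Dividing `g` by the unit `shift h g` gives `X ^ h + p₀` with the coefficients of `p₀` in `I`.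
Solving `shift h ((X ^ h + p₀) * q) = 1` forces the product to be monic of degree `h`. Its solution
`q` has constant coefficient `1` modulo `I`, so it is a unit. -/
theorem exists_isDistinguished_mul_unit (hI : IsNilpotent I) {h : ℕ} {g : B⟦X⟧}
    (hlt : ∀ s, s < h → coeff s g ∈ I) (hh : IsUnit (coeff h g)) :
    ∃ (p : B⟦X⟧) (u : B⟦X⟧ˣ), IsDistinguished I h p ∧ g = p * u := by
  have hv : IsUnit (shift h g) := by
    rw [isUnit_iff_constantCoeff, ← coeff_zero_eq_constantCoeff_apply, coeff_shift, zero_add]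
    exact hh
  obtain ⟨v, hv⟩ := hv
  have hg0 : ∀ s, coeff s (g - X ^ h * (v : B⟦X⟧)) ∈ I := by
    intro s
    rw [hv, map_sub, coeff_X_pow_mul']
    split_ifs with hs
    · rw [coeff_shift, Nat.sub_add_cancel hs, sub_self]
      exact zero_mem _
    · simpa using hlt s (not_le.mp hs)
  set p₀ := (g - X ^ h * (v : B⟦X⟧)) * (↑v⁻¹ : B⟦X⟧) with hp₀
  have hp₀I : ∀ s, coeff s p₀ ∈ I := coeff_mul_mem_ideal_of_coeff_left_mem_ideal' hg0
  have hgv : X ^ h + p₀ = g * (↑v⁻¹ : B⟦X⟧) := by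
    rw [hp₀, sub_mul, mul_assoc, Units.mul_inv]
    ring
  obtain ⟨q, hq⟩ := (bijective_shift_mul hI h hp₀I).surjective 1
  simp only at hq
  have hq' : q + shift h (p₀ * q) = 1 := by
    rw [← hq, add_mul, map_add, shift_X_pow_mul]
  have hqu : IsUnit q := by
    rw [isUnit_iff_constantCoeff, ← coeff_zero_eq_constantCoeff_apply]
    refine isUnit_of_sub_mem hI (b := 1) isUnit_one ?_
    have h0 : coeff 0 q - 1 = - coeff (0 + h) (p₀ * q) := by
      have := congrArg (coeff 0) hq'
      rw [map_add, coeff_shift, coeff_zero_one] at this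
      rw [← this]
      ring
    rw [h0]
    exact neg_mem (coeff_mul_mem_ideal_of_coeff_left_mem_ideal' hp₀I _)
  obtain ⟨w, rfl⟩ := hqu
  have hcoeff : ∀ s, coeff (s + h) ((X ^ h + p₀) * (w : B⟦X⟧)) = coeff s 1 := fun s => by
    rw [← hq, coeff_shift]
  refine ⟨(X ^ h + p₀) * (w : B⟦X⟧), v * w⁻¹, ⟨?_, ?_, ?_⟩, ?_⟩
  · simpa using hcoeff 0
  · intro s hs
    have := hcoeff (s - h)
    rwa [Nat.sub_add_cancel hs.le, coeff_one, if_neg (by omega)] at this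
  · intro s hs
    rw [add_mul, map_add, coeff_X_pow_mul', if_neg (by omega), zero_add]
    exact coeff_mul_mem_ideal_of_coeff_left_mem_ideal' hp₀I _
  · rw [hgv, Units.val_mul, mul_comm (v : B⟦X⟧), mul_assoc, Units.mul_inv_cancel_left, mul_assoc,
      Units.inv_mul, mul_one]

end Weierstrass

/-! ### Points of arc schemes -/

section ArcPoints

variable {k : Type*} [Field k] {ι : Type*} {B C : Type*} [CommRing B] [Algebra k B]
  [CommRing C] [Algebra k C]

/-- This translates equations between arc coordinates into identities of power series over `B`. -/
theorem apply_hsCoeff (ψ : MvPolynomial (ι × ℕ) k →ₐ[k] B) (F : MvPolynomial ι k) (s : ℕ) :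
    ψ (hsCoeff F s) = PowerSeries.coeff s
      (MvPolynomial.aeval (fun i => PowerSeries.mk fun s => ψ (MvPolynomial.X (i, s))) F) := by
  have h : ((PowerSeries.mapAlgHom ψ).comp (HS (k := k) (ι := ι))) =
      MvPolynomial.aeval (fun i => PowerSeries.mk fun s => ψ (MvPolynomial.X (i, s))) := by
    apply MvPolynomial.algHom_ext
    intro i
    ext s
    simp [HS, PowerSeries.mapAlgHom_apply]
  rw [← h]
  simp [hsCoeff, PowerSeries.mapAlgHom_apply]

/-- A `B`-valued arc on `Spec (k[Z]/I)`, given by its coordinates. -/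
def arcLift (I : Ideal (MvPolynomial ι k)) (Z : ι → PowerSeries B)
    (hZ : I ≤ RingHom.ker (MvPolynomial.aeval (R := k) Z)) : ArcRing I →ₐ[k] B :=
  Ideal.Quotient.liftₐ (arcIdeal I)
    (MvPolynomial.aeval fun p => PowerSeries.coeff p.2 (Z p.1)) (by
      suffices h : arcIdeal I ≤ RingHom.ker
          (MvPolynomial.aeval (R := k) fun p : ι × ℕ => PowerSeries.coeff p.2 (Z p.1)) from
        fun a ha => h ha
      refine Ideal.span_le.mpr ?_
      rintro _ ⟨F, hF, s, rfl⟩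
      have := hZ hF
      rw [RingHom.mem_ker] at this
      show MvPolynomial.aeval _ _ = 0
      rw [apply_hsCoeff]
      simp only [MvPolynomial.aeval_X]
      have h2 : (fun i => PowerSeries.mk fun s => PowerSeries.coeff s (Z i)) = Z := by
        ext; simp
      rw [h2, this, map_zero])

@[simp]
theorem arcLift_mk_X {I : Ideal (MvPolynomial ι k)} {Z : ι → PowerSeries B}
    (hZ : I ≤ RingHom.ker (MvPolynomial.aeval (R := k) Z)) (p : ι × ℕ) :
    arcLift I Z hZ (Ideal.Quotient.mk (arcIdeal I) (MvPolynomial.X p)) =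
      PowerSeries.coeff p.2 (Z p.1) := by
  exact MvPolynomial.aeval_X _ _

theorem arcRing_ringHom_ext {I : Ideal (MvPolynomial ι k)} {C : Type*} [CommRing C]
    {ψ ψ' : ArcRing I →+* C}
    (hk : ∀ a : k, ψ (algebraMap k _ a) = ψ' (algebraMap k _ a))
    (h : ∀ p, ψ (Ideal.Quotient.mk _ (MvPolynomial.X p)) =
      ψ' (Ideal.Quotient.mk _ (MvPolynomial.X p))) : ψ = ψ' := by
  apply Ideal.Quotient.ringHom_ext
  apply MvPolynomial.ringHom_ext
  · exact hk
  · exact h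

theorem arcRing_algHom_ext {I : Ideal (MvPolynomial ι k)} {ψ ψ' : ArcRing I →ₐ[k] B}
    (h : ∀ p, ψ (Ideal.Quotient.mk _ (MvPolynomial.X p)) =
      ψ' (Ideal.Quotient.mk _ (MvPolynomial.X p))) : ψ = ψ' := by
  apply AlgHom.coe_ringHom_injective
  exact arcRing_ringHom_ext (fun a => by simp) h

/-- The coordinates of the arc defined by a morphism from the coordinate ring of the arc scheme. -/
def arcCoord {I : Ideal (MvPolynomial ι k)} (ψ : ArcRing I →ₐ[k] B) (i : ι) : PowerSeries B :=
  PowerSeries.mk fun s => ψ (Ideal.Quotient.mk _ (MvPolynomial.X (i, s)))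

@[simp]
theorem coeff_arcCoord {I : Ideal (MvPolynomial ι k)} (ψ : ArcRing I →ₐ[k] B) (i : ι) (s : ℕ) :
    PowerSeries.coeff s (arcCoord ψ i) = ψ (Ideal.Quotient.mk _ (MvPolynomial.X (i, s))) := by
  simp [arcCoord]

theorem map_universalArc_mk {I : Ideal (MvPolynomial ι k)} (ψ : ArcRing I →ₐ[k] B)
    (F : MvPolynomial ι k) :
    PowerSeries.map (ψ : ArcRing I →+* B) (universalArc I (Ideal.Quotient.mk I F)) =
      MvPolynomial.aeval (arcCoord ψ) F := by
  ext s
  have h := apply_hsCoeff (ψ.comp (Ideal.Quotient.mkₐ k (arcIdeal I))) F s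
  simp only [AlgHom.comp_apply, Ideal.Quotient.mkₐ_eq_mk] at h
  unfold arcCoord
  rw [← h]
  simp [universalArc, hsCoeff]

theorem aeval_arcCoord_eq_zero {I : Ideal (MvPolynomial ι k)} (ψ : ArcRing I →ₐ[k] B)
    {F : MvPolynomial ι k} (hF : F ∈ I) : MvPolynomial.aeval (arcCoord ψ) F = 0 := by
  rw [← map_universalArc_mk, Ideal.Quotient.eq_zero_iff_mem.mpr hF, map_zero, map_zero]

theorem order_eq_of_coeff_eq_zero_iff {R S : Type*} [Semiring R] [Semiring S]
    {f : PowerSeries R} {g : PowerSeries S}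
    (h : ∀ s, PowerSeries.coeff s f = 0 ↔ PowerSeries.coeff s g = 0) : f.order = g.order := by
  apply le_antisymm
  · exact PowerSeries.le_order _ _ fun s hs =>
      (h s).mp (PowerSeries.coeff_of_lt_order _ hs)
  · exact PowerSeries.le_order _ _ fun s hs =>
      (h s).mpr (PowerSeries.coeff_of_lt_order _ hs)

/-- The semivaluation of an arc can be computed with any morphism whose kernel is the given
point. -/
theorem arcOrd_eq_order {I : Ideal (MvPolynomial ι k)} (α : PrimeSpectrum (ArcRing I))
    (ψ : ArcRing I →ₐ[k] B) (hψ : RingHom.ker ψ = α.asIdeal) (F : MvPolynomial ι k) :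
    arcOrd α (Ideal.Quotient.mk I F) = (MvPolynomial.aeval (arcCoord ψ) F).order := by
  rw [← map_universalArc_mk, arcOrd]
  refine order_eq_of_coeff_eq_zero_iff fun s => ?_
  rw [PowerSeries.coeff_map, PowerSeries.coeff_map, Ideal.algebraMap_residueField_eq_zero, ← hψ,
    RingHom.mem_ker]
  rfl

@[simp]
theorem aeval_binomial [Fintype ι] (Z : ι → B) (ℓ : ι → ℤ) :
    MvPolynomial.aeval Z (binomial k ℓ) =
      ∏ i, Z i ^ (ℓ i).toNat - ∏ i, Z i ^ (-ℓ i).toNat := by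
  simp [binomial, map_prod]

end ArcPoints

/-! ### Isomorphisms of affine formal schemes from isomorphisms of their truncations -/

section Formal

theorem continuous_limitTopology {X R : Type*} [TopologicalSpace X] [CommRing R] (I : Ideal R)
    (f : X → AdicCompletion I R)
    (h : ∀ e, @Continuous _ _ _ ⊥ fun x => AdicCompletion.evalₐ I e (f x)) :
    @Continuous _ _ _ (limitTopology I) f := by
  rw [continuous_iInf_rng]
  exact fun e => continuous_induced_rng.mpr (h e)

theorem continuous_evalₐ {R : Type*} [CommRing R] (I : Ideal R) (e : ℕ) :
    @Continuous _ _ (limitTopology I) ⊥ (AdicCompletion.evalₐ I e) := by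
  refine continuous_iff_le_induced.mpr ?_
  exact iInf_le _ e

theorem factorPow_evalₐ {R : Type*} [CommRing R] (I : Ideal R) {m n : ℕ} (hle : m ≤ n)
    (x : AdicCompletion I R) :
    Ideal.Quotient.factorPow I hle (AdicCompletion.evalₐ I n x) = AdicCompletion.evalₐ I m x := by
  obtain ⟨y, rfl⟩ := AdicCompletion.mk_surjective I R x
  rw [AdicCompletion.evalₐ_mk, AdicCompletion.evalₐ_mk]
  exact AdicCompletion.Ideal.mk_eq_mk I hle y

/-- Compatible isomorphisms of the truncations induce an isomorphism of the inverse limits. It is a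
homeomorphism because continuity into a limit of discrete rings is tested on each truncation. -/
theorem formalIsoOver_of_quotientEquiv {K R S : Type*} [CommRing K] [CommRing R] [CommRing S]
    (φ : K →+* R) (I : Ideal R) (ψ : K →+* S) (J : Ideal S)
    (θ : ∀ e, (R ⧸ I ^ e) ≃+* (S ⧸ J ^ e))
    (hθ : ∀ {m n} (hle : m ≤ n) (x : R),
      Ideal.Quotient.factorPow J hle (θ n (Ideal.Quotient.mk _ x)) =
        θ m (Ideal.Quotient.mk _ x))
    (hK : ∀ e a, θ e (Ideal.Quotient.mk _ (φ a)) = Ideal.Quotient.mk _ (ψ a)) :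
    FormalIsoOver φ I ψ J := by
  have hθ' : ∀ {m n} (hle : m ≤ n) (x : R ⧸ I ^ n),
      Ideal.Quotient.factorPow J hle (θ n x) = θ m (Ideal.Quotient.factorPow I hle x) := by
    intro m n hle x
    obtain ⟨x, rfl⟩ := Ideal.Quotient.mk_surjective x
    rw [hθ hle]
    simp
  have hθs : ∀ {m n} (hle : m ≤ n) (y : S ⧸ J ^ n),
      Ideal.Quotient.factorPow I hle ((θ n).symm y) =
        (θ m).symm (Ideal.Quotient.factorPow J hle y) := by
    intro m n hle y
    rw [RingEquiv.eq_symm_apply, ← hθ' hle, RingEquiv.apply_symm_apply]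
  let F : AdicCompletion I R →+* AdicCompletion J S :=
    AdicCompletion.liftRingHom J
      (fun e => ((θ e : (R ⧸ I ^ e) →+* _)).comp (AdicCompletion.evalₐ I e : _ →+* _))
      (fun {m n} hle => by
        ext x
        simp only [RingHom.comp_apply]
        exact (hθ' hle _).trans (congrArg (θ m) (factorPow_evalₐ I hle x)))
  let G : AdicCompletion J S →+* AdicCompletion I R :=
    AdicCompletion.liftRingHom I
      (fun e => (((θ e).symm : (S ⧸ J ^ e) →+* _)).comp (AdicCompletion.evalₐ J e : _ →+* _))
      (fun {m n} hle => by
        ext x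
        simp only [RingHom.comp_apply]
        exact (hθs hle _).trans (congrArg (θ m).symm (factorPow_evalₐ J hle x)))
  have hF : ∀ e x, AdicCompletion.evalₐ J e (F x) = θ e (AdicCompletion.evalₐ I e x) := fun e x =>
    AdicCompletion.evalₐ_liftRingHom _ _ _ _ _
  have hG : ∀ e x, AdicCompletion.evalₐ I e (G x) = (θ e).symm (AdicCompletion.evalₐ J e x) :=
    fun e x => AdicCompletion.evalₐ_liftRingHom _ _ _ _ _
  let E : AdicCompletion I R ≃+* AdicCompletion J S := RingEquiv.ofRingHom F G
    (by
      ext1 x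
      refine AdicCompletion.ext_evalₐ fun e => ?_
      simp [hF, hG])
    (by
      ext1 x
      refine AdicCompletion.ext_evalₐ fun e => ?_
      simp [hF, hG])
  refine ⟨E, fun a => ?_, ?_⟩
  · refine AdicCompletion.ext_evalₐ fun e => (hF e _).trans ?_
    rw [AlgHom.commutes, AlgHom.commutes]
    exact hK e a
  · let := limitTopology I
    let := limitTopology J
    refine (Homeomorph.mk E.toEquiv ?_ ?_).isHomeomorph
    · refine continuous_limitTopology J _ fun e => ?_
      let : TopologicalSpace (R ⧸ I ^ e) := ⊥
      let : TopologicalSpace (S ⧸ J ^ e) := ⊥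
      have h1 : Continuous (θ e) := continuous_bot
      exact (h1.comp (continuous_evalₐ I e)).congr fun x => (hF e x).symm
    · refine continuous_limitTopology I _ fun e => ?_
      let : TopologicalSpace (R ⧸ I ^ e) := ⊥
      let : TopologicalSpace (S ⧸ J ^ e) := ⊥
      have h1 : Continuous (θ e).symm := continuous_bot
      exact (h1.comp (continuous_evalₐ J e)).congr fun x => (hG e x).symm

end Formal

namespace AffineToricData

variable {N : Type*} [AddCommGroup N] {d c : ℕ} (D : AffineToricData N d c) {n : N}

/-! ### Toric arcs -/

section Torus

variable {G : Type*} [CommGroup G]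

/-- The value of the character `m` at the point of the torus with coordinates `τ` in the basis
`m_1, …, m_d`. -/
def torusEval (τ : Fin d → G) (m : Module.Dual ℤ N) : G :=
  ∏ j, τ j ^ D.basis.repr m j

theorem torusEval_zero (τ : Fin d → G) : D.torusEval τ 0 = 1 := by
  simp [torusEval]

theorem torusEval_add (τ : Fin d → G) (m m' : Module.Dual ℤ N) :
    D.torusEval τ (m + m') = D.torusEval τ m * D.torusEval τ m' := by
  simp [torusEval, zpow_add, Finset.prod_mul_distrib]

@[simp]
theorem torusEval_gen_inl (τ : Fin d → G) (i : Fin d) :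
    D.torusEval τ (D.gen (Sum.inl i)) = τ i := by
  have hb : D.gen (Sum.inl i) = D.basis i := by simp [basis]
  rw [torusEval, hb, Finset.prod_eq_single i]
  · simp
  · intro j _ hj
    simp [Finsupp.single_eq_of_ne hj]
  · simp

theorem map_torusEval {G' : Type*} [CommGroup G'] (ψ : G →* G') (τ : Fin d → G)
    (m : Module.Dual ℤ N) : ψ (D.torusEval τ m) = D.torusEval (fun j => ψ (τ j)) m := by
  simp [torusEval, map_prod]

/-- The binomial equation attached to `ℓ_q` on a torus. -/
theorem prod_pow_toNat_ell_eq_iff (q : Fin c) (u : Fin d ⊕ Fin c → G) :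
    ∏ i, u i ^ (D.ell q i).toNat = ∏ i, u i ^ (-D.ell q i).toNat ↔
      u (Sum.inr q) = D.torusEval (fun j => u (Sum.inl j)) (D.gen (Sum.inr q)) := by
  have hz : ∀ (x : G) (a : ℤ), x ^ a.toNat / x ^ (-a).toNat = x ^ a := fun x a => by
    rw [← zpow_natCast, ← zpow_natCast, div_eq_mul_inv, ← zpow_sub, Int.toNat_sub_toNat_neg]
  rw [← div_eq_one, ← Finset.prod_div_distrib]
  simp only [hz]
  rw [Fintype.prod_sum_type]
  simp only [ell, Sum.elim_inl, Sum.elim_inr, zpow_neg, Finset.prod_inv_distrib]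
  rw [Finset.prod_eq_single q, Pi.single_eq_same, zpow_one, inv_mul_eq_one, torusEval, eq_comm]
  · intro b _ hb
    simp [Pi.single_eq_of_ne hb]
  · simp

end Torus

theorem apply_nonneg_of_mem (hn : (1 : ℝ) ⊗ₜ[ℤ] n ∈ D.cone) {m : Module.Dual ℤ N}
    (hm : m ∈ dualMonoid D.cone) : 0 ≤ m n := by
  have := hm _ hn
  rw [realPairing_tmul, mul_one] at this
  exact_mod_cast this

theorem height_cast (hn : (1 : ℝ) ⊗ₜ[ℤ] n ∈ D.cone) (i : Fin d ⊕ Fin c) :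
    (D.height n i : ℤ) = D.gen i n :=
  Int.toNat_of_nonneg (D.apply_nonneg_of_mem hn (D.gen_mem i))

/-- Evaluating `∑ ℓ_{q,i} m_i = 0` at `n` shows that both monomials of `F_q` have the same order in
`t` along the toric arcs. This is where the arcs and the equations meet. -/
theorem sum_toNat_ell_mul_height (hn : (1 : ℝ) ⊗ₜ[ℤ] n ∈ D.cone) (q : Fin c) :
    ∑ i, (D.ell q i).toNat * D.height n i = ∑ i, (-D.ell q i).toNat * D.height n i := by
  zify
  simp only [D.height_cast hn]
  rw [← sub_eq_zero, ← Finset.sum_sub_distrib]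
  have h := congrArg (fun m : Module.Dual ℤ N => m n) (D.sum_ell q)
  simp only [LinearMap.sum_apply, LinearMap.smul_apply, LinearMap.zero_apply, smul_eq_mul] at h
  rw [← h]
  refine Finset.sum_congr rfl fun i _ => ?_
  rw [← sub_mul]
  congr 1
  simp

section Arc

open PowerSeries

variable {k : Type*} [Field k] {E : Type*} [CommRing E] [Algebra k E]
  {E' : Type*} [CommRing E'] [Algebra k E']

/-- The morphism `k[S_σ] → E⟦t⟧`, `χ^m ↦ t^⟨n, m⟩ τ^m`. -/
def toricComorphism (k : Type*) [Field k] [Algebra k E] (hn : (1 : ℝ) ⊗ₜ[ℤ] n ∈ D.cone)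
    (τ : Fin d → E⟦X⟧ˣ) : AddMonoidAlgebra k (dualMonoid D.cone) →ₐ[k] E⟦X⟧ :=
  AddMonoidAlgebra.lift k E⟦X⟧ (dualMonoid D.cone)
    { toFun := fun m => X ^ ((m.toAdd : Module.Dual ℤ N) n).toNat *
        (↑(D.torusEval τ (m.toAdd : Module.Dual ℤ N)) : E⟦X⟧)
      map_one' := by simp [torusEval_zero]
      map_mul' := fun m m' => by
        have h : (((m * m').toAdd : Module.Dual ℤ N) n).toNat =
            ((m.toAdd : Module.Dual ℤ N) n).toNat + ((m'.toAdd : Module.Dual ℤ N) n).toNat := by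
          rw [toAdd_mul, AddSubmonoid.coe_add, LinearMap.add_apply]
          exact Int.toNat_add (D.apply_nonneg_of_mem hn (Subtype.prop _))
            (D.apply_nonneg_of_mem hn (Subtype.prop _))
        rw [h, toAdd_mul, AddSubmonoid.coe_add, torusEval_add, Units.val_mul, pow_add]
        ring }

theorem toricComorphism_single (hn : (1 : ℝ) ⊗ₜ[ℤ] n ∈ D.cone) (τ : Fin d → E⟦X⟧ˣ)
    (m : dualMonoid D.cone) (a : k) :
    D.toricComorphism k hn τ (AddMonoidAlgebra.single m a) =
      a • (X ^ ((m : Module.Dual ℤ N) n).toNat * (↑(D.torusEval τ (m : Module.Dual ℤ N)) : E⟦X⟧)) := by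
  rw [toricComorphism, AddMonoidAlgebra.lift_single]
  rfl

theorem toricComorphism_comp_toricMap (hn : (1 : ℝ) ⊗ₜ[ℤ] n ∈ D.cone) (τ : Fin d → E⟦X⟧ˣ) :
    (D.toricComorphism k hn τ).comp (D.toricMap k) =
      MvPolynomial.aeval fun i => X ^ D.height n i * (↑(D.torusEval τ (D.gen i)) : E⟦X⟧) := by
  apply MvPolynomial.algHom_ext
  intro i
  simp [toricMap, toricComorphism_single, height]

/-- The `E`-point `Z_i = t^⟨n, m_i⟩ τ^{m_i}` of the arc scheme of `V_σ`. -/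
def toricArc (k : Type*) [Field k] [Algebra k E] (hn : (1 : ℝ) ⊗ₜ[ℤ] n ∈ D.cone)
    (τ : Fin d → E⟦X⟧ˣ) : ArcRing (D.toricIdeal k) →ₐ[k] E :=
  arcLift _ (fun i => X ^ D.height n i * (↑(D.torusEval τ (D.gen i)) : E⟦X⟧)) (by
    rw [← D.toricComorphism_comp_toricMap hn]
    intro F hF
    have hF' : D.toricMap k F = 0 := hF
    show D.toricComorphism k hn τ (D.toricMap k F) = 0
    rw [hF', map_zero])

@[simp]
theorem toricArc_mk_X (hn : (1 : ℝ) ⊗ₜ[ℤ] n ∈ D.cone) (τ : Fin d → E⟦X⟧ˣ)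
    (p : (Fin d ⊕ Fin c) × ℕ) :
    D.toricArc k hn τ (Ideal.Quotient.mk _ (MvPolynomial.X p)) =
      coeff p.2 (X ^ D.height n p.1 * (↑(D.torusEval τ (D.gen p.1)) : E⟦X⟧)) :=
  arcLift_mk_X _ _

theorem comp_toricArc (hn : (1 : ℝ) ⊗ₜ[ℤ] n ∈ D.cone) (ψ : E →ₐ[k] E') (τ : Fin d → E⟦X⟧ˣ) :
    ψ.comp (D.toricArc k hn τ) = D.toricArc k hn
      fun j => Units.map (PowerSeries.map (ψ : E →+* E') : E⟦X⟧ →* E'⟦X⟧) (τ j) := by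
  apply arcRing_algHom_ext
  intro p
  rw [AlgHom.comp_apply, toricArc_mk_X, toricArc_mk_X, ← map_torusEval, Units.coe_map]
  simp [coeff_X_pow_mul']
  split_ifs <;> simp

theorem arcCoord_toricArc (hn : (1 : ℝ) ⊗ₜ[ℤ] n ∈ D.cone) (τ : Fin d → E⟦X⟧ˣ)
    (i : Fin d ⊕ Fin c) :
    arcCoord (D.toricArc k hn τ) i = X ^ D.height n i * (↑(D.torusEval τ (D.gen i)) : E⟦X⟧) := by
  ext s
  simp

/-- The power series `∑_s Z_{i, s + ⟨n, m_i⟩} t^s` for `i ≤ d`. -/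
def tail (x : D.BaseVars n → E) (i : Fin d) : E⟦X⟧ :=
  PowerSeries.mk fun s => x ⟨(i, s + D.height n (Sum.inl i)), Nat.le_add_left _ _⟩

@[simp]
theorem coeff_tail (x : D.BaseVars n → E) (i : Fin d) (s : ℕ) :
    coeff s (D.tail x i) = x ⟨(i, s + D.height n (Sum.inl i)), Nat.le_add_left _ _⟩ := by
  simp [tail]

theorem isUnit_tail {x : D.BaseVars n → E}
    (hx : ∀ i, IsUnit (x ⟨(i, D.height n (Sum.inl i)), le_rfl⟩))
    (i : Fin d) : IsUnit (D.tail x i) := by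
  rw [isUnit_iff_constantCoeff, ← coeff_zero_eq_constantCoeff_apply, coeff_tail]
  simpa using hx i

theorem map_tail (ψ : E →+* E') (x : D.BaseVars n → E) (i : Fin d) :
    PowerSeries.map ψ (D.tail x i) = D.tail (fun p => ψ (x p)) i := by
  ext s
  simp

/-- The tails as units. -/
def tailUnit (x : D.BaseVars n → E) (hx : ∀ i, IsUnit (x ⟨(i, D.height n (Sum.inl i)), le_rfl⟩))
    (i : Fin d) : E⟦X⟧ˣ :=
  (D.isUnit_tail hx i).unit

@[simp]
theorem coe_tailUnit (x : D.BaseVars n → E)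
    (hx : ∀ i, IsUnit (x ⟨(i, D.height n (Sum.inl i)), le_rfl⟩)) (i : Fin d) :
    (D.tailUnit x hx i : E⟦X⟧) = D.tail x i := rfl

theorem comp_toricArc_tailUnit (hn : (1 : ℝ) ⊗ₜ[ℤ] n ∈ D.cone) (ψ : E →ₐ[k] E')
    (x : D.BaseVars n → E) (hx : ∀ i, IsUnit (x ⟨(i, D.height n (Sum.inl i)), le_rfl⟩))
    (y : D.BaseVars n → E') (hy : ∀ i, IsUnit (y ⟨(i, D.height n (Sum.inl i)), le_rfl⟩))
    (h : ∀ p, ψ (x p) = y p) :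
    ψ.comp (D.toricArc k hn (D.tailUnit x hx)) = D.toricArc k hn (D.tailUnit y hy) := by
  rw [comp_toricArc]
  congr 1
  funext j
  apply Units.ext
  ext s
  simp [h]

theorem toricArc_tailUnit_mk_X (hn : (1 : ℝ) ⊗ₜ[ℤ] n ∈ D.cone) (x : D.BaseVars n → E)
    (hx : ∀ i, IsUnit (x ⟨(i, D.height n (Sum.inl i)), le_rfl⟩)) (p : D.BaseVars n) :
    D.toricArc k hn (D.tailUnit x hx)
      (Ideal.Quotient.mk _ (MvPolynomial.X (Sum.inl p.1.1, p.1.2))) = x p := by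
  obtain ⟨⟨i, s⟩, hs⟩ := p
  simp only at hs
  rw [toricArc_mk_X]
  simp only [torusEval_gen_inl, coe_tailUnit]
  rw [coeff_X_pow_mul', if_pos hs, coeff_tail]
  congr 3
  exact Nat.sub_add_cancel hs

end Arc

/-! ### The generic point of the Nash set -/

section Generic

open PowerSeries

variable (k : Type*) [Field k]

/-- The variables `Z_{i,s}`, `i ≤ d`, `s ≥ ⟨n, m_i⟩`, as elements of `K`. -/
def baseVar (n : N) (p : D.BaseVars n) : D.BaseField k n :=
  algebraMap (MvPolynomial (D.BaseVars n) k) (D.BaseField k n) (MvPolynomial.X p)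

theorem baseVar_ne_zero (p : D.BaseVars n) : D.baseVar k n p ≠ 0 := by
  rw [baseVar, Ne, FaithfulSMul.algebraMap_eq_zero_iff]
  exact MvPolynomial.X_ne_zero p

theorem aeval_baseVar (F : MvPolynomial (D.BaseVars n) k) :
    MvPolynomial.aeval (D.baseVar k n) F = algebraMap _ (D.BaseField k n) F := by
  have : MvPolynomial.aeval (D.baseVar k n) =
      IsScalarTower.toAlgHom k (MvPolynomial (D.BaseVars n) k) (D.BaseField k n) := by
    apply MvPolynomial.algHom_ext
    intro i
    simp [baseVar]
  rw [this]
  rfl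

/-- The units of `K⟦t⟧` with independent variables as coefficients. -/
def genericUnit (n : N) (i : Fin d) : (D.BaseField k n)⟦X⟧ˣ :=
  D.tailUnit (D.baseVar k n) (fun _ => (D.baseVar_ne_zero k _).isUnit) i

/-- The generic arc of the Nash set. -/
def genericArc (hn : (1 : ℝ) ⊗ₜ[ℤ] n ∈ D.cone) :
    ArcRing (D.toricIdeal k) →ₐ[k] D.BaseField k n :=
  D.toricArc k hn (D.genericUnit k n)

/-- The point of the arc scheme of `V_σ` defined by the generic arc. -/
def nashPoint (hn : (1 : ℝ) ⊗ₜ[ℤ] n ∈ D.cone) : PrimeSpectrum (ArcRing (D.toricIdeal k)) :=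
  ⟨RingHom.ker (D.genericArc k hn), RingHom.ker_isPrime _⟩

/-- Distinct Laurent monomials in the leading coefficients are linearly independent. -/
theorem sum_laurent_ne_zero {T : Type*} (S : Finset T) (a : T → Fin d → ℤ)
    (ha : Set.InjOn a S) (b : T → k) {m₀ : T} (hm₀ : m₀ ∈ S) (hb : b m₀ ≠ 0) :
    ∑ m ∈ S, b m • ∏ j, (D.baseVar k n ⟨(j, D.height n (Sum.inl j)), le_rfl⟩) ^ a m j ≠ 0 := by
  classical
  intro h
  set t : Fin d → D.BaseField k n :=
    fun j => D.baseVar k n ⟨(j, D.height n (Sum.inl j)), le_rfl⟩ with ht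
  have htne : ∀ j, t j ≠ 0 := fun j => D.baseVar_ne_zero k _
  have hinj : Function.Injective (MvPolynomial.aeval (R := k) t) := by
    have hcomp : MvPolynomial.aeval (R := k) t = (MvPolynomial.aeval (D.baseVar k n)).comp
        (MvPolynomial.rename fun j => (⟨(j, D.height n (Sum.inl j)), le_rfl⟩ : D.BaseVars n)) := by
      apply MvPolynomial.algHom_ext
      intro j
      simp [ht]
    rw [hcomp, AlgHom.coe_comp]
    refine Function.Injective.comp ?_ (MvPolynomial.rename_injective _ fun i j hij => ?_)
    · intro x y hxy
      rw [aeval_baseVar, aeval_baseVar] at hxy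
      exact IsFractionRing.injective _ _ hxy
    · simpa using congrArg (fun p : D.BaseVars n => p.1.1) hij
  -- `B` bounds the absolute values of all exponents, so multiplying by `∏ t_j ^ B` turns the
  -- Laurent polynomial into a polynomial with distinct monomials.
  set B : ℕ := ∑ m ∈ S, ∑ j, (a m j).natAbs with hB
  have hBle : ∀ m ∈ S, ∀ j, 0 ≤ a m j + B := by
    intro m hm j
    have h1 : (a m j).natAbs ≤ B :=
      (Finset.single_le_sum (f := fun j => (a m j).natAbs) (fun _ _ => Nat.zero_le _)
        (Finset.mem_univ j)).trans
      (Finset.single_le_sum (f := fun m => ∑ j, (a m j).natAbs) (fun _ _ => Nat.zero_le _) hm)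
    omega
  set e : T → Fin d →₀ ℕ :=
    fun m => Finsupp.equivFunOnFinite.symm fun j => (a m j + B).toNat with he
  have he' : ∀ m ∈ S, m ≠ m₀ → e m ≠ e m₀ := by
    intro m hm hne heq
    refine hne (ha hm hm₀ ?_)
    funext j
    have := DFunLike.congr_fun heq j
    simp only [he, Finsupp.equivFunOnFinite_symm_apply_apply] at this
    have h1 := hBle m hm j
    have h2 := hBle m₀ hm₀ j
    omega
  have hP : MvPolynomial.aeval t (∑ m ∈ S, MvPolynomial.monomial (e m) (b m)) = 0 := by
    have h2 := congrArg (· * ∏ j, t j ^ B) h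
    simp only [zero_mul, Finset.sum_mul] at h2
    rw [map_sum, ← h2]
    refine Finset.sum_congr rfl fun m hm => ?_
    rw [MvPolynomial.aeval_monomial, smul_mul_assoc, ← Finset.prod_mul_distrib, Algebra.smul_def,
      Finsupp.prod_fintype _ _ (fun _ => pow_zero _)]
    congr 1
    refine Finset.prod_congr rfl fun j _ => ?_
    rw [← zpow_natCast (t j) B, ← zpow_add₀ (htne j), ← zpow_natCast]
    congr 1
    simp only [he, Finsupp.equivFunOnFinite_symm_apply_apply]
    exact Int.toNat_of_nonneg (hBle m hm j)
  rw [← map_zero (MvPolynomial.aeval (R := k) t)] at hP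
  have h3 := congrArg (MvPolynomial.coeff (e m₀)) (hinj hP)
  rw [MvPolynomial.coeff_sum, Finset.sum_eq_single m₀] at h3
  · exact hb (by simpa using h3)
  · intro m hm hne
    rw [MvPolynomial.coeff_monomial, if_neg (he' m hm hne)]
  · exact fun hn => absurd hm₀ hn

/-- At the least exponent `⟨n, m⟩` occurring in `f`, the coefficient is a Laurent polynomial in the
independent leading variables. Distinct characters give distinct exponents, so nothing cancels. -/
theorem order_toricComorphism_genericUnit (hn : (1 : ℝ) ⊗ₜ[ℤ] n ∈ D.cone)
    (f : AddMonoidAlgebra k (dualMonoid D.cone)) :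
    (D.toricComorphism k hn (D.genericUnit k n) f).order = D.toricOrd n f := by
  classical
  set w : dualMonoid D.cone → ℕ := fun m => ((m : Module.Dual ℤ N) n).toNat with hw
  have hcoeff : ∀ s, coeff s (D.toricComorphism k hn (D.genericUnit k n) f) =
      ∑ m ∈ f.coeff.support, f.coeff m • (if w m ≤ s then
        coeff (s - w m) (↑(D.torusEval (D.genericUnit k n) (m : Module.Dual ℤ N)) :
          (D.BaseField k n)⟦X⟧) else 0) := by
    intro s
    have hf : f = ∑ m ∈ f.coeff.support, AddMonoidAlgebra.single m (f.coeff m) :=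
      f.sum_coeff_single.symm
    conv_lhs => rw [hf]
    rw [map_sum, map_sum]
    refine Finset.sum_congr rfl fun m _ => ?_
    rw [toricComorphism_single, ← coeff_X_pow_mul']
    simp [hw]
  have hle : D.toricOrd n f ≤ (D.toricComorphism k hn (D.genericUnit k n) f).order := by
    refine PowerSeries.le_order _ _ fun s hs => ?_
    rw [hcoeff]
    refine Finset.sum_eq_zero fun m hm => ?_
    have h1 : (s : ℕ∞) < w m := hs.trans_le (iInf₂_le m hm)
    rw [if_neg (not_le.mpr (by exact_mod_cast h1)), smul_zero]
  refine le_antisymm ?_ hle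
  -- For `f = 0` the infimum is empty, hence `⊤`, and the bound is trivial.
  rcases f.coeff.support.eq_empty_or_nonempty with h0 | h0
  · simp [toricOrd, h0]
  obtain ⟨m₀, hm₀, hmin⟩ := Finset.exists_min_image _ w h0
  refine (PowerSeries.order_le (w m₀) ?_).trans (le_iInf₂ fun m hm => by exact_mod_cast hmin m hm)
  rw [hcoeff]
  have hS : ∀ m ∈ f.coeff.support, f.coeff m • (if w m ≤ w m₀ then
      coeff (w m₀ - w m) (↑(D.torusEval (D.genericUnit k n) (m : Module.Dual ℤ N)) :
        (D.BaseField k n)⟦X⟧) else 0) = if w m = w m₀ then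
      f.coeff m • ∏ j, (D.baseVar k n ⟨(j, D.height n (Sum.inl j)), le_rfl⟩) ^
        (D.basis.repr (m : Module.Dual ℤ N) j) else 0 := by
    intro m hm
    by_cases h : w m = w m₀
    · rw [if_pos h.le, if_pos h, h, Nat.sub_self, coeff_zero_eq_constantCoeff_apply]
      congr 1
      have := D.map_torusEval (G' := (D.BaseField k n)ˣ)
        (Units.map ((constantCoeff (R := D.BaseField k n)) :
          (D.BaseField k n)⟦X⟧ →* D.BaseField k n))
        (D.genericUnit k n) m
      have h2 := congrArg Units.val this
      rw [Units.coe_map] at h2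
      refine h2.trans ?_
      simp only [torusEval, Units.coe_prod, Units.val_zpow_eq_zpow_val]
      refine Finset.prod_congr rfl fun j _ => ?_
      congr 1
      simp only [Units.coe_map, genericUnit, coe_tailUnit]
      show constantCoeff _ = _
      rw [← coeff_zero_eq_constantCoeff_apply, coeff_tail]
      simp
    · rw [if_neg h, if_neg, smul_zero]
      have := hmin m hm
      omega
  rw [Finset.sum_congr rfl hS, ← Finset.sum_filter]
  refine D.sum_laurent_ne_zero k _
    (fun (m : dualMonoid D.cone) j => D.basis.repr (m : Module.Dual ℤ N) j) ?_ f.coeff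
    (m₀ := m₀) (Finset.mem_filter.mpr ⟨hm₀, rfl⟩) (Finsupp.mem_support_iff.mp hm₀)
  intro m _ m' _ h
  apply Subtype.ext
  apply D.basis.repr.injective
  ext j
  exact congrFun h j

theorem arcOrd_nashPoint (hn : (1 : ℝ) ⊗ₜ[ℤ] n ∈ D.cone)
    (F : MvPolynomial (Fin d ⊕ Fin c) k) :
    arcOrd (D.nashPoint k hn) (Ideal.Quotient.mk (D.toricIdeal k) F) =
      D.toricOrd n (D.toricMap k F) := by
  rw [arcOrd_eq_order _ (D.genericArc k hn) rfl, ← D.order_toricComorphism_genericUnit k hn]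
  congr 1
  rw [← AlgHom.comp_apply, toricComorphism_comp_toricMap]
  congr 2
  funext i
  exact D.arcCoord_toricArc hn _ i

/-- An arc with the orders of the generic arc is a toric arc. -/
theorem exists_eq_toricArc (hn : (1 : ℝ) ⊗ₜ[ℤ] n ∈ D.cone) {L : Type*} [Field L] [Algebra k L]
    (ψ : ArcRing (D.toricIdeal k) →ₐ[k] L)
    (hψ : ∀ i, (arcCoord ψ i).order = D.height n i) :
    ∃ τ : Fin d → L⟦X⟧ˣ, ψ = D.toricArc k hn τ := by
  have hz : ∀ i, ∃ u : L⟦X⟧ˣ, arcCoord ψ i = X ^ D.height n i * (u : L⟦X⟧) := by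
    intro i
    obtain ⟨v, hv⟩ : X ^ D.height n i ∣ arcCoord ψ i :=
      PowerSeries.X_pow_dvd_iff.mpr fun s hs =>
        PowerSeries.coeff_of_lt_order _ (by rw [hψ]; exact_mod_cast hs)
    have hv' : IsUnit v := by
      rw [isUnit_iff_constantCoeff, ← coeff_zero_eq_constantCoeff_apply, isUnit_iff_ne_zero]
      intro h0
      have h1 : coeff (D.height n i) (arcCoord ψ i) = 0 := by
        rw [hv, coeff_X_pow_mul', if_pos le_rfl, Nat.sub_self, h0]
      have h2 : arcCoord ψ i ≠ 0 := fun h => by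
        have := hψ i
        rw [h, order_zero] at this
        exact ENat.top_ne_natCast _ this
      refine coeff_order h2 ?_
      rw [hψ]
      exact h1
    exact ⟨hv'.unit, hv⟩
  choose u hu using hz
  refine ⟨fun j => u (Sum.inl j), arcRing_algHom_ext fun p => ?_⟩
  rw [toricArc_mk_X, ← coeff_arcCoord, hu]
  congr 3
  rcases p with ⟨i | q, s⟩
  · simp
  simp only
  rw [← D.prod_pow_toNat_ell_eq_iff]
  have h0 := aeval_arcCoord_eq_zero ψ
    (D.ciIdeal_le_toricIdeal k (Ideal.subset_span ⟨q, rfl⟩))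
  rw [aeval_binomial, sub_eq_zero] at h0
  -- Both sides carry the same power of `t`; cancelling it leaves the binomial equation for the
  -- units. Only the equations of `W` are used.
  simp only [hu, mul_pow, Finset.prod_mul_distrib, ← pow_mul, Finset.prod_pow_eq_pow_sum] at h0
  simp only [mul_comm (D.height n _), D.sum_toNat_ell_mul_height hn] at h0
  apply Units.ext
  simpa using X_pow_mul_cancel h0

/-- The coordinate ring of the scheme of toric arcs. -/
abbrev LaurentRing (n : N) : Type _ :=
  Localization (Submonoid.closure (Set.range fun j : Fin d =>
    (MvPolynomial.X ⟨(j, D.height n (Sum.inl j)), le_rfl⟩ : MvPolynomial (D.BaseVars n) k)))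

theorem isUnit_laurentVar (i : Fin d) : IsUnit (algebraMap (MvPolynomial (D.BaseVars n) k)
    (D.LaurentRing k n) (MvPolynomial.X ⟨(i, D.height n (Sum.inl i)), le_rfl⟩)) :=
  IsLocalization.map_units (M := Submonoid.closure (Set.range fun j : Fin d =>
    (MvPolynomial.X ⟨(j, D.height n (Sum.inl j)), le_rfl⟩ : MvPolynomial (D.BaseVars n) k))) _
    ⟨_, Submonoid.subset_closure ⟨i, rfl⟩⟩

/-- The specialization of the coefficients of toric arcs. -/
def laurentLift {L : Type*} [CommRing L] [Algebra k L] (x : D.BaseVars n → L)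
    (hx : ∀ i, IsUnit (x ⟨(i, D.height n (Sum.inl i)), le_rfl⟩)) : D.LaurentRing k n →ₐ[k] L :=
  IsLocalization.liftAlgHom (M := Submonoid.closure (Set.range fun j : Fin d =>
    (MvPolynomial.X ⟨(j, D.height n (Sum.inl j)), le_rfl⟩ : MvPolynomial (D.BaseVars n) k)))
    (f := MvPolynomial.aeval x) (by
      rintro ⟨y, hy⟩
      induction hy using Submonoid.closure_induction with
      | mem y hy =>
        obtain ⟨j, rfl⟩ := hy
        simpa using hx j
      | one => simp
      | mul y z _ _ h1 h2 =>
        simp only [map_mul]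
        exact h1.mul h2)

theorem laurentLift_algebraMap {L : Type*} [CommRing L] [Algebra k L] (x : D.BaseVars n → L)
    (hx : ∀ i, IsUnit (x ⟨(i, D.height n (Sum.inl i)), le_rfl⟩))
    (F : MvPolynomial (D.BaseVars n) k) :
    D.laurentLift k x hx (algebraMap _ _ F) = MvPolynomial.aeval x F := by
  simp only [laurentLift, IsLocalization.liftAlgHom_apply]
  exact IsLocalization.lift_eq _ _

/-- Every toric arc is a specialization of the universal one, whose coefficients lie in the Laurent
ring. -/
theorem toricArc_eq_laurentLift_comp (hn : (1 : ℝ) ⊗ₜ[ℤ] n ∈ D.cone) {L : Type*} [CommRing L]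
    [Algebra k L] (x : D.BaseVars n → L)
    (hx : ∀ i, IsUnit (x ⟨(i, D.height n (Sum.inl i)), le_rfl⟩)) :
    D.toricArc k hn (D.tailUnit x hx) = (D.laurentLift k x hx).comp
      (D.toricArc k hn (D.tailUnit (fun p => algebraMap _ _ (MvPolynomial.X p))
        (D.isUnit_laurentVar k))) := by
  symm
  refine D.comp_toricArc_tailUnit hn _ _ _ _ _ fun p => ?_
  rw [laurentLift_algebraMap, MvPolynomial.aeval_X]

/-- Since the Laurent ring embeds in `K`, the generic arc has the same kernel as the universal toric
arc. -/
theorem laurentLift_baseVar_injective : Function.Injective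
    (D.laurentLift k (D.baseVar k n) fun _ => (D.baseVar_ne_zero k _).isUnit) := by
  unfold laurentLift
  rw [IsLocalization.coe_liftAlgHom, IsLocalization.lift_injective_iff]
  intro a b
  constructor
  · intro h
    have := congrArg
      (D.laurentLift k (D.baseVar k n) fun _ => (D.baseVar_ne_zero k _).isUnit) h
    rwa [laurentLift_algebraMap, laurentLift_algebraMap] at this
  · intro h
    have h' : MvPolynomial.aeval (D.baseVar k n) a = MvPolynomial.aeval (D.baseVar k n) b := h
    rw [aeval_baseVar, aeval_baseVar] at h'
    rw [IsFractionRing.injective _ _ h']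

theorem exists_eq_tailUnit {L : Type*} [CommRing L] (τ : Fin d → L⟦X⟧ˣ) :
    ∃ (x : D.BaseVars n → L) (hx : ∀ i, IsUnit (x ⟨(i, D.height n (Sum.inl i)), le_rfl⟩)),
      τ = D.tailUnit x hx := by
  refine ⟨fun p => coeff (p.1.2 - D.height n (Sum.inl p.1.1)) (τ p.1.1 : L⟦X⟧), fun i => ?_, ?_⟩
  · simp only [Nat.sub_self, coeff_zero_eq_constantCoeff_apply]
    exact isUnit_iff_constantCoeff.mp (τ i).isUnit
  · funext i
    apply Units.ext
    ext s
    simp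

/-- The orders of the coordinates alone force `α` to be toric. A function vanishing on the generic
arc vanishes on the universal toric arc, hence on its specialization `α`. -/
theorem nashPoint_le_of_arcOrd_eq (hn : (1 : ℝ) ⊗ₜ[ℤ] n ∈ D.cone)
    (α : PrimeSpectrum (ArcRing (D.toricIdeal k)))
    (hα : ∀ i, arcOrd α (Ideal.Quotient.mk (D.toricIdeal k) (MvPolynomial.X i)) = D.height n i) :
    (D.nashPoint k hn).asIdeal ≤ α.asIdeal := by
  let ψ : ArcRing (D.toricIdeal k) →ₐ[k] α.asIdeal.ResidueField :=
    IsScalarTower.toAlgHom k _ _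
  have hker : RingHom.ker ψ = α.asIdeal := by
    ext x
    exact Ideal.algebraMap_residueField_eq_zero
  obtain ⟨τ, hτ⟩ := D.exists_eq_toricArc k hn ψ fun i => by
    rw [← hα i, arcOrd_eq_order α ψ hker, MvPolynomial.aeval_X]
  obtain ⟨x, hx, rfl⟩ := D.exists_eq_tailUnit (n := n) τ
  intro F hF
  have hF' : D.toricArc k hn (D.genericUnit k n) F = 0 := hF
  rw [← hker, RingHom.mem_ker, hτ, D.toricArc_eq_laurentLift_comp k hn, AlgHom.comp_apply]
  unfold genericUnit at hF'
  rw [D.toricArc_eq_laurentLift_comp k hn, AlgHom.comp_apply] at hF'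
  rw [(map_eq_zero_iff _ (D.laurentLift_baseVar_injective k)).mp hF', map_zero]

theorem toricOrd_toricMap_X (i : Fin d ⊕ Fin c) :
    D.toricOrd n (D.toricMap k (MvPolynomial.X i)) = D.height n i := by
  rw [toricMap, MvPolynomial.aeval_X, toricOrd, AddMonoidAlgebra.coeff_single]
  simp [height, Finsupp.support_single]

theorem isGenericPoint_nashPoint (hn : (1 : ℝ) ⊗ₜ[ℤ] n ∈ D.cone) :
    IsGenericPoint (D.nashPoint k hn) (D.nashSet k n) := by
  rw [isGenericPoint_def, nashSet]
  apply Set.Subset.antisymm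
  · refine closure_mono (Set.singleton_subset_iff.mpr ?_)
    exact D.arcOrd_nashPoint k hn
  · refine closure_minimal (fun α hα => ?_) isClosed_closure
    rw [← PrimeSpectrum.le_iff_mem_closure]
    exact D.nashPoint_le_of_arcOrd_eq k hn α fun i => by
      rw [← D.toricOrd_toricMap_X k i]
      exact hα _

end Generic

end AffineToricData

/-! ### Morphisms out of the base change of an adic completion. -/

/-- Finite generation of `I` is essential: it identifies the kernel of the projection to level `e`
with the `e`-th power of the extended ideal. -/
theorem sub_mem_map_pow_of_evalₐ_eq {R : Type*} [CommRing R] {I : Ideal R} (hI : I.FG) {e : ℕ}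
    {x y : AdicCompletion I R} (h : AdicCompletion.evalₐ I e x = AdicCompletion.evalₐ I e y) :
    x - y ∈ (I.map (algebraMap R (AdicCompletion I R))) ^ e := by
  have h1 : x - y ∈ (AdicCompletion.eval I R e).ker := by
    rw [LinearMap.mem_ker, ← AdicCompletion.factor_evalₐ_eq_eval _ _ (Ideal.mul_top _).ge,
      map_sub, h, sub_self, map_zero]
  rw [← AdicCompletion.pow_smul_top_eq_ker_eval hI] at h1
  rw [← Ideal.map_pow]
  have h2 := Ideal.smul_top_eq_map (S := AdicCompletion I R) (I ^ e)
  exact (congrArg (x - y ∈ ·) h2).mp h1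

theorem includeRight_algebraMap {k K F : Type*} [CommRing k]
    [CommRing K] [Algebra k K] [CommRing F] [Algebra k F] (a : k) :
    (Algebra.TensorProduct.includeRight : F →ₐ[k] K ⊗[k] F) (algebraMap k F a) =
      algebraMap K (K ⊗[k] F) (algebraMap k K a) := by
  rw [AlgHom.commutes, ← IsScalarTower.algebraMap_apply]

/-- `K` and `A` need not generate the tensor product, but they do so modulo the `e`-th power of the
extended ideal, which both morphisms kill. -/
theorem tensorProduct_ringHom_ext {k K F A B : Type*} [CommRing k] [CommRing K] [Algebra k K]
    [CommRing F] [Algebra k F] [CommRing A] [CommRing B] {u : A →+* F} {I : Ideal F} {e : ℕ}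
    (hu : ∀ f, ∃ a, f - u a ∈ I ^ e) {ρ ρ' : K ⊗[k] F →+* B}
    (hρ : (I.map (Algebra.TensorProduct.includeRight : F →ₐ[k] K ⊗[k] F)) ^ e ≤ RingHom.ker ρ)
    (hρ' : (I.map (Algebra.TensorProduct.includeRight : F →ₐ[k] K ⊗[k] F)) ^ e ≤ RingHom.ker ρ')
    (hK : ∀ a : K, ρ (algebraMap K _ a) = ρ' (algebraMap K _ a))
    (hA : ∀ a, ρ ((Algebra.TensorProduct.includeRight : F →ₐ[k] K ⊗[k] F) (u a)) =
      ρ' ((Algebra.TensorProduct.includeRight : F →ₐ[k] K ⊗[k] F) (u a))) : ρ = ρ' := by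
  refine RingHom.ext fun x => ?_
  induction x using TensorProduct.induction_on with
  | zero => rw [map_zero, map_zero]
  | add x y hx hy => rw [map_add, map_add, hx, hy]
  | tmul b f =>
    obtain ⟨a, ha⟩ := hu f
    have hmem := Ideal.mem_map_of_mem (Algebra.TensorProduct.includeRight : F →ₐ[k] K ⊗[k] F) ha
    rw [Ideal.map_pow, map_sub] at hmem
    have h1 := hρ hmem
    have h2 := hρ' hmem
    rw [RingHom.mem_ker, map_sub, sub_eq_zero] at h1 h2
    have hb : b ⊗ₜ[k] f = algebraMap K (K ⊗[k] F) b *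
        (Algebra.TensorProduct.includeRight : F →ₐ[k] K ⊗[k] F) f := by
      simp
    rw [hb, map_mul, map_mul, h1, h2, hK, hA]

theorem exists_tensorProduct_lift {k K F B : Type*} [CommRing k] [CommRing K] [Algebra k K]
    [CommRing F] [Algebra k F] [CommRing B] [Algebra k B] (φ : K →ₐ[k] B) (χ : F →ₐ[k] B) :
    ∃ ρ : K ⊗[k] F →ₐ[k] B, (∀ a, ρ (algebraMap K _ a) = φ a) ∧
      ∀ f, ρ ((Algebra.TensorProduct.includeRight : F →ₐ[k] K ⊗[k] F) f) = χ f :=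
  ⟨Algebra.TensorProduct.lift φ χ fun _ _ => Commute.all _ _, by simp, by simp⟩

namespace AffineToricData

variable {N : Type*} [AddCommGroup N] {d c : ℕ} (D : AffineToricData N d c) {n : N}

/-! ### Points of the formal model -/

section Model

open PowerSeries

variable {k : Type*} [Field k] {B : Type*} [CommRing B] [Algebra k B]
  {C : Type*} [CommRing C] [Algebra k C]

/-- The polynomials `t^⟨n, m_i⟩ + ∑_{s < ⟨n, m_i⟩} p_{i,s} t^s`. -/
def modelSeries (p : D.ModelVars n → B) (i : Fin d ⊕ Fin c) : B⟦X⟧ :=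
  PowerSeries.mk fun s =>
    if h : s < D.height n i then p ⟨(i, s), h⟩ else if s = D.height n i then 1 else 0

theorem coeff_modelSeries (p : D.ModelVars n → B) (q : D.ModelVars n) :
    coeff q.1.2 (D.modelSeries p q.1.1) = p q := by
  obtain ⟨⟨i, s⟩, h⟩ := q
  simp only at h
  simp [modelSeries, h]

theorem modelSeries_injective : Function.Injective (D.modelSeries (B := B) (n := n)) := by
  intro p p' h
  funext q
  rw [← D.coeff_modelSeries p, h, D.coeff_modelSeries]

theorem map_modelSeries (ψ : B →+* C) (p : D.ModelVars n → B) (i : Fin d ⊕ Fin c) :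
    PowerSeries.map ψ (D.modelSeries p i) = D.modelSeries (fun q => ψ (p q)) i := by
  ext s
  simp only [modelSeries, coeff_map, coeff_mk]
  split_ifs <;> simp

theorem isDistinguished_modelSeries {I : Ideal B} {p : D.ModelVars n → B} (hp : ∀ q, p q ∈ I)
    (i : Fin d ⊕ Fin c) : IsDistinguished I (D.height n i) (D.modelSeries p i) where
  coeff_eq := by simp [modelSeries]
  coeff_gt s hs := by simp [modelSeries, not_lt.mpr hs.le, hs.ne']
  coeff_lt s hs := by simp [modelSeries, hs, hp]

theorem eq_modelSeries_of_isDistinguished {I : Ideal B} {P : Fin d ⊕ Fin c → B⟦X⟧}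
    (hP : ∀ i, IsDistinguished I (D.height n i) (P i)) :
    P = D.modelSeries fun q : D.ModelVars n => coeff q.1.2 (P q.1.1) := by
  funext i
  ext s
  simp only [modelSeries, coeff_mk]
  split_ifs with h1 h2
  · rfl
  · rw [h2, (hP i).coeff_eq]
  · exact (hP i).coeff_gt s (by omega)

/-- The equations of the model. -/
def IsModelPoint (p : D.ModelVars n → B) : Prop :=
  ∀ q, ∏ i, D.modelSeries p i ^ (D.ell q i).toNat = ∏ i, D.modelSeries p i ^ (-D.ell q i).toNat

theorem IsModelPoint.map {D : AffineToricData N d c} {p : D.ModelVars n → B}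
    (hp : D.IsModelPoint p) (ψ : B →+* C) : D.IsModelPoint fun q => ψ (p q) := by
  intro q
  have := congrArg (PowerSeries.map ψ) (hp q)
  simpa only [map_prod, map_pow, map_modelSeries] using this

theorem aeval_truncate_hsCoeff (p : D.ModelVars n → B)
    (F : MvPolynomial (Fin d ⊕ Fin c) k) (s : ℕ) :
    MvPolynomial.aeval p (D.truncate k n (hsCoeff F s)) =
      coeff s (MvPolynomial.aeval (D.modelSeries p) F) := by
  rw [← AlgHom.comp_apply, apply_hsCoeff]
  congr 3
  funext i
  ext s
  simp only [coeff_mk, AlgHom.comp_apply, truncate, MvPolynomial.aeval_X, modelSeries]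
  split_ifs <;> simp

variable (k n) in
/-- The tautological point of the model. -/
def modelX (q : D.ModelVars n) : D.ModelRing k n (Set.range D.ell) :=
  Ideal.Quotient.mk _ (MvPolynomial.X q)

variable (k n) in
theorem isModelPoint_modelX : D.IsModelPoint (D.modelX n k) := by
  intro q
  rw [← sub_eq_zero, ← aeval_binomial (k := k)]
  ext s
  rw [← aeval_truncate_hsCoeff, map_zero]
  have h : MvPolynomial.aeval (D.modelX n k) =
      Ideal.Quotient.mkₐ k (D.modelIdeal k n (Set.range D.ell)) := by
    apply MvPolynomial.algHom_ext
    intro q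
    simp [modelX]
  rw [h, Ideal.Quotient.mkₐ_eq_mk, Ideal.Quotient.eq_zero_iff_mem]
  exact Ideal.subset_span ⟨_, ⟨q, rfl⟩, s, rfl⟩

/-- The morphism defined by a point of the model. -/
def modelLift {p : D.ModelVars n → B} (hp : D.IsModelPoint p) :
    D.ModelRing k n (Set.range D.ell) →ₐ[k] B :=
  Ideal.Quotient.liftₐ _ (MvPolynomial.aeval p) (by
    suffices h : D.modelIdeal k n (Set.range D.ell) ≤
        RingHom.ker (MvPolynomial.aeval (R := k) p) from fun a ha => h ha
    refine Ideal.span_le.mpr ?_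
    rintro _ ⟨_, ⟨q, rfl⟩, s, rfl⟩
    show MvPolynomial.aeval p _ = 0
    rw [aeval_truncate_hsCoeff, aeval_binomial, hp q, sub_self, map_zero])

@[simp]
theorem modelLift_modelX {p : D.ModelVars n → B} (hp : D.IsModelPoint p) (q : D.ModelVars n) :
    D.modelLift (k := k) hp (D.modelX n k q) = p q :=
  MvPolynomial.aeval_X _ _

theorem modelOrigin_eq_span :
    D.modelOrigin k n (Set.range D.ell) = Ideal.span (Set.range (D.modelX n k)) := by
  rw [modelOrigin, Ideal.map_span, ← Set.range_comp]
  rfl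

instance : Finite (D.ModelVars n) := by
  have : Finite ((i : Fin d ⊕ Fin c) × Fin (D.height n i)) := inferInstance
  exact Finite.of_injective
    (fun q : D.ModelVars n => (⟨q.1.1, ⟨q.1.2, q.2⟩⟩ : (i : Fin d ⊕ Fin c) × Fin (D.height n i)))
    (fun ⟨⟨i, s⟩, h⟩ ⟨⟨i', s'⟩, h'⟩ he => by
      simp only [Sigma.mk.injEq] at he
      obtain ⟨rfl, h2⟩ := he
      simpa using h2)

theorem modelOrigin_fg : (D.modelOrigin k n (Set.range D.ell)).FG := by
  rw [modelOrigin_eq_span]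
  exact ⟨(Set.finite_range (D.modelX n k)).toFinset, by rw [Set.Finite.coe_toFinset]⟩

end Model

section FormalModel

variable {k : Type u} [Field k] {K : Type u} [Field K] [Algebra k K]
  {B : Type*} [CommRing B]

variable (n k K) in
/-- The canonical morphism from the coordinate ring of the model. -/
def modelToFormal :
    D.ModelRing k n (Set.range D.ell) →+* K ⊗[k] D.FormalModel k n (Set.range D.ell) :=
  RingHom.comp (Algebra.TensorProduct.includeRight :
      D.FormalModel k n (Set.range D.ell) →ₐ[k] K ⊗[k] D.FormalModel k n (Set.range D.ell))
    (algebraMap (D.ModelRing k n (Set.range D.ell)) (D.FormalModel k n (Set.range D.ell)))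

variable (n k K) in
/-- The coordinates of the model over `K`. -/
def formalX (q : D.ModelVars n) : K ⊗[k] D.FormalModel k n (Set.range D.ell) :=
  D.modelToFormal n k K (D.modelX n k q)

variable (n k K) in
theorem isModelPoint_formalX : D.IsModelPoint (D.formalX n k K) :=
  (D.isModelPoint_modelX n k).map (D.modelToFormal n k K)

theorem baseChangeIdeal_eq_map : D.baseChangeIdeal k n (Set.range D.ell) K =
    (D.modelOrigin k n (Set.range D.ell)).map (D.modelToFormal n k K) :=
  Ideal.map_map _ _

theorem baseChangeIdeal_eq_span :
    D.baseChangeIdeal k n (Set.range D.ell) K = Ideal.span (Set.range (D.formalX n k K)) := by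
  rw [baseChangeIdeal_eq_map]
  exact (congrArg (Ideal.map (D.modelToFormal n k K)) D.modelOrigin_eq_span).trans
    ((Ideal.map_span _ _).trans (congrArg Ideal.span (Set.range_comp _ _).symm))

theorem modelToFormal_algebraMap (a : k) :
    D.modelToFormal n k K (algebraMap k _ a) = algebraMap K _ (algebraMap k K a) := by
  have h : algebraMap (D.ModelRing k n (Set.range D.ell)) (D.FormalModel k n (Set.range D.ell))
      (algebraMap k _ a) = algebraMap k _ a :=
    (IsScalarTower.algebraMap_apply k (D.ModelRing k n (Set.range D.ell))
      (D.FormalModel k n (Set.range D.ell)) a).symm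
  exact (congrArg (Algebra.TensorProduct.includeRight :
    D.FormalModel k n (Set.range D.ell) →ₐ[k] K ⊗[k] D.FormalModel k n (Set.range D.ell)) h).trans
    (includeRight_algebraMap a)

theorem exists_sub_mem_map_pow (f : D.FormalModel k n (Set.range D.ell)) (e : ℕ) :
    ∃ a : D.ModelRing k n (Set.range D.ell), f - algebraMap _ _ a ∈
      ((D.modelOrigin k n (Set.range D.ell)).map
        (algebraMap _ (D.FormalModel k n (Set.range D.ell)))) ^ e := by
  obtain ⟨a, ha⟩ := Ideal.Quotient.mk_surjective
    (AdicCompletion.evalₐ (D.modelOrigin k n (Set.range D.ell)) e f)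
  refine ⟨a, ?_⟩
  exact sub_mem_map_pow_of_evalₐ_eq D.modelOrigin_fg (by rw [← ha, AlgHom.commutes]; rfl)

/-- A morphism killing a power of the ideal of definition is determined by its values on `K` and
on the coordinates of the model. -/
theorem formal_ringHom_ext {e : ℕ}
    {ρ ρ' : K ⊗[k] D.FormalModel k n (Set.range D.ell) →+* B}
    (hρ : (D.baseChangeIdeal k n (Set.range D.ell) K) ^ e ≤ RingHom.ker ρ)
    (hρ' : (D.baseChangeIdeal k n (Set.range D.ell) K) ^ e ≤ RingHom.ker ρ')
    (hK : ∀ a : K, ρ (algebraMap K _ a) = ρ' (algebraMap K _ a))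
    (hX : ∀ q, ρ (D.formalX n k K q) = ρ' (D.formalX n k K q)) : ρ = ρ' := by
  have hA : ρ.comp (D.modelToFormal n k K) = ρ'.comp (D.modelToFormal n k K) := by
    apply Ideal.Quotient.ringHom_ext
    apply MvPolynomial.ringHom_ext
    · intro a
      have h2 := hK (algebraMap k K a)
      rw [← modelToFormal_algebraMap] at h2
      exact h2
    · exact hX
  exact tensorProduct_ringHom_ext (fun f => D.exists_sub_mem_map_pow f e) hρ hρ' hK
    fun a => RingHom.congr_fun hA a

variable [Algebra k B]

/-- The point `p` defines a morphism on the model ring sending the origin ideal into `I`. As `I ^ e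
= ⊥`, it factors through level `e` of the completion, and then combines with `φ` on the tensor
product. -/
theorem exists_formalLift {I : Ideal B} {e : ℕ} (hI : I ^ e = ⊥) (φ : K →ₐ[k] B)
    {p : D.ModelVars n → B} (hpI : ∀ q, p q ∈ I) (hp : D.IsModelPoint p) :
    ∃ ρ : K ⊗[k] D.FormalModel k n (Set.range D.ell) →ₐ[k] B,
      (∀ a, ρ (algebraMap K _ a) = φ a) ∧ (∀ q, ρ (D.formalX n k K q) = p q) ∧
      (D.baseChangeIdeal k n (Set.range D.ell) K) ^ e ≤ RingHom.ker ρ := by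
  have hmap : (D.modelOrigin k n (Set.range D.ell)).map (D.modelLift (k := k) hp) ≤ I := by
    rw [modelOrigin_eq_span, Ideal.map_span, Ideal.span_le]
    rintro _ ⟨_, ⟨q, rfl⟩, rfl⟩
    simpa using hpI q
  have hker : ∀ a ∈ (D.modelOrigin k n (Set.range D.ell)) ^ e, D.modelLift (k := k) hp a = 0 := by
    intro a ha
    have h1 := Ideal.mem_map_of_mem (D.modelLift (k := k) hp) ha
    rw [Ideal.map_pow] at h1
    have h2 := Ideal.pow_right_mono hmap e h1
    rwa [hI] at h2
  let lam : D.FormalModel k n (Set.range D.ell) →ₐ[k] B :=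
    (Ideal.Quotient.liftₐ _ (D.modelLift (k := k) hp) hker).comp
      ((AdicCompletion.evalₐ (D.modelOrigin k n (Set.range D.ell)) e).restrictScalars k)
  obtain ⟨ρ, hφ, hlam⟩ := exists_tensorProduct_lift φ lam
  have hX : ∀ q, ρ (D.formalX n k K q) = p q := by
    intro q
    refine (hlam _).trans ?_
    simp only [lam, AlgHom.comp_apply, AlgHom.restrictScalars_apply, AlgHom.commutes]
    exact D.modelLift_modelX hp q
  refine ⟨ρ, hφ, hX, ?_⟩
  · intro x hx
    have h1 := Ideal.mem_map_of_mem ρ hx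
    rw [Ideal.map_pow, baseChangeIdeal_eq_span, Ideal.map_span] at h1
    have h3 : Ideal.span (ρ '' Set.range (D.formalX n k K)) ≤ I := by
      rw [Ideal.span_le]
      rintro _ ⟨_, ⟨q, rfl⟩, rfl⟩
      rw [hX]
      exact hpI q
    have h2 := Ideal.pow_right_mono h3 e h1
    rwa [hI] at h2

end FormalModel

/-! ### Nilpotent deformations of the generic arc -/

section Deformation

open PowerSeries

variable {k : Type*} [Field k] {B : Type*} [CommRing B] [Algebra k B]
  {C : Type*} [CommRing C] [Algebra k C]

variable (k) in
/-- The generic arc, seen as an arc on `W`. -/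
def ciGenericArc (hn : (1 : ℝ) ⊗ₜ[ℤ] n ∈ D.cone) :
    ArcRing (D.ciIdeal k) →ₐ[k] D.BaseField k n where
  toRingHom := (D.genericArc k hn : _ →+* D.BaseField k n).comp
    (arcRestrict (D.ciIdeal_le_toricIdeal k))
  commutes' a := (D.genericArc k hn).commutes a

theorem ciGenericArc_mk_X (hn : (1 : ℝ) ⊗ₜ[ℤ] n ∈ D.cone) (p : (Fin d ⊕ Fin c) × ℕ) :
    D.ciGenericArc k hn (Ideal.Quotient.mk _ (MvPolynomial.X p)) =
      coeff p.2 (X ^ D.height n p.1 *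
        (↑(D.torusEval (D.genericUnit k n) (D.gen p.1)) : (D.BaseField k n)⟦X⟧)) :=
  D.toricArc_mk_X hn _ p

theorem ciGenericArc_baseVar (hn : (1 : ℝ) ⊗ₜ[ℤ] n ∈ D.cone) (p : D.BaseVars n) :
    D.ciGenericArc k hn (Ideal.Quotient.mk _ (MvPolynomial.X (Sum.inl p.1.1, p.1.2))) =
      D.baseVar k n p :=
  D.toricArc_tailUnit_mk_X hn _ (fun _ => (D.baseVar_ne_zero k _).isUnit) p

/-- A `B`-point `ψ` of the arc scheme of `W` which reduces to the generic arc modulo `I`, with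
prescribed coordinates `Z_{i,s}`, `i ≤ d`, `s ≥ ⟨n, m_i⟩`. -/
structure IsArcDeformation (hn : (1 : ℝ) ⊗ₜ[ℤ] n ∈ D.cone) (I : Ideal B)
    (φ : D.BaseField k n →ₐ[k] B) (ψ : ArcRing (D.ciIdeal k) →ₐ[k] B) : Prop where
  sub_mem : ∀ x, ψ x - φ (D.ciGenericArc k hn x) ∈ I
  apply_baseVar : ∀ p : D.BaseVars n,
    ψ (Ideal.Quotient.mk _ (MvPolynomial.X (Sum.inl p.1.1, p.1.2))) = φ (D.baseVar k n p)

/-- The Weierstrass factorization of the coordinates of an arc. -/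
def IsFactorization (ψ : ArcRing (D.ciIdeal k) →ₐ[k] B) (p : D.ModelVars n → B)
    (U : Fin d → B⟦X⟧ˣ) : Prop :=
  ∀ i, arcCoord ψ i = D.modelSeries p i * (↑(D.torusEval U (D.gen i)) : B⟦X⟧)

variable {D} {hn : (1 : ℝ) ⊗ₜ[ℤ] n ∈ D.cone} {I : Ideal B} {φ : D.BaseField k n →ₐ[k] B}

theorem IsArcDeformation.map {J : Ideal C} {ψ : ArcRing (D.ciIdeal k) →ₐ[k] B}
    (h : D.IsArcDeformation hn I φ ψ) (χ : B →ₐ[k] C) (hχ : I ≤ J.comap χ) :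
    D.IsArcDeformation hn J (χ.comp φ) (χ.comp ψ) where
  sub_mem x := by
    have := hχ (h.sub_mem x)
    rwa [Ideal.mem_comap, map_sub] at this
  apply_baseVar p := congrArg χ (h.apply_baseVar p)

theorem IsFactorization.map {ψ : ArcRing (D.ciIdeal k) →ₐ[k] B} {p : D.ModelVars n → B}
    {U : Fin d → B⟦X⟧ˣ} (h : D.IsFactorization ψ p U) (χ : B →ₐ[k] C) :
    D.IsFactorization (χ.comp ψ) (fun q => χ (p q))
      fun j => Units.map (PowerSeries.map (χ : B →+* C) : B⟦X⟧ →* C⟦X⟧) (U j) := by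
  intro i
  have h1 := congrArg (PowerSeries.map (χ : B →+* C)) (h i)
  rw [map_mul, map_modelSeries] at h1
  rw [← map_torusEval, Units.coe_map]
  refine Eq.trans ?_ h1
  ext s
  simp

/-- Weierstrass preparation applies because the generic arc has zero coefficients below degree `⟨n,
m_i⟩` and a unit in that degree. Uniqueness of the factorization then separates each binomial
equation into its distinguished part and its unit part. -/
theorem IsArcDeformation.exists_isFactorization {ψ : ArcRing (D.ciIdeal k) →ₐ[k] B}
    (h : D.IsArcDeformation hn I φ ψ) (hI : IsNilpotent I) :
    ∃ p : D.ModelVars n → B, (∀ q, p q ∈ I) ∧ D.IsModelPoint p ∧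
      ∃ U, D.IsFactorization ψ p U := by
  have hW : ∀ i, ∃ (P : B⟦X⟧) (u : B⟦X⟧ˣ), IsDistinguished I (D.height n i) P ∧
      arcCoord ψ i = P * u := by
    intro i
    refine exists_isDistinguished_mul_unit hI (fun s hs => ?_) ?_
    · have := h.sub_mem (Ideal.Quotient.mk _ (MvPolynomial.X (i, s)))
      rw [ciGenericArc_mk_X, coeff_X_pow_mul', if_neg (not_le.mpr hs), map_zero, sub_zero] at this
      simpa using this
    · have := h.sub_mem (Ideal.Quotient.mk _ (MvPolynomial.X (i, D.height n i)))
      rw [ciGenericArc_mk_X, coeff_X_pow_mul', if_pos le_rfl, Nat.sub_self,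
        coeff_zero_eq_constantCoeff_apply] at this
      rw [coeff_arcCoord]
      exact isUnit_of_sub_mem hI ((isUnit_iff_constantCoeff.mp (Units.isUnit _)).map φ) this
  choose P u hP hu using hW
  have heq : ∀ q, ∏ i, P i ^ (D.ell q i).toNat = ∏ i, P i ^ (-D.ell q i).toNat ∧
      ∏ i, u i ^ (D.ell q i).toNat = ∏ i, u i ^ (-D.ell q i).toNat := by
    intro q
    have h0 := aeval_arcCoord_eq_zero ψ (F := binomial k (D.ell q)) (Ideal.subset_span ⟨q, rfl⟩)
    rw [aeval_binomial, sub_eq_zero] at h0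
    simp only [hu, mul_pow, Finset.prod_mul_distrib] at h0
    have hd1 := IsDistinguished.prod Finset.univ fun i => (hP i).pow (D.ell q i).toNat
    have hd2 := IsDistinguished.prod Finset.univ fun i => (hP i).pow (-D.ell q i).toNat
    -- The two products must be distinguished of the same degree for uniqueness to apply.
    rw [D.sum_toNat_ell_mul_height hn] at hd1
    refine hd1.unique hI hd2 ?_
    simpa using h0
  have hPp := D.eq_modelSeries_of_isDistinguished hP
  refine ⟨_, fun q => (hP q.1.1).coeff_lt _ q.2, ?_, fun j => u (Sum.inl j), ?_⟩
  · intro q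
    rw [← hPp]
    exact (heq q).1
  · intro i
    rw [← hPp, hu]
    congr 2
    rcases i with i | q
    · rw [torusEval_gen_inl]
    · exact (D.prod_pow_toNat_ell_eq_iff q u).mp (heq q).2

theorem IsFactorization.unique (hI : IsNilpotent I) {ψ : ArcRing (D.ciIdeal k) →ₐ[k] B}
    {p p' : D.ModelVars n → B} (hp : ∀ q, p q ∈ I) (hp' : ∀ q, p' q ∈ I) {U U' : Fin d → B⟦X⟧ˣ}
    (h : D.IsFactorization ψ p U) (h' : D.IsFactorization ψ p' U') : p = p' :=
  D.modelSeries_injective <| funext fun i =>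
    ((D.isDistinguished_modelSeries hp i).unique hI (D.isDistinguished_modelSeries hp' i)
      ((h i).symm.trans (h' i))).1

theorem IsArcDeformation.shift_arcCoord {ψ : ArcRing (D.ciIdeal k) →ₐ[k] B}
    (h : D.IsArcDeformation hn I φ ψ) (j : Fin d) :
    shift (D.height n (Sum.inl j)) (arcCoord ψ (Sum.inl j)) =
      D.tail (fun p => φ (D.baseVar k n p)) j := by
  ext s
  rw [coeff_shift, coeff_arcCoord, coeff_tail, ← h.apply_baseVar]

/-- The prescribed coefficients fix `shift (P_j U_j)`, which determines `U_j` by injectivity; the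
other coordinates are then determined by the torus characters. -/
theorem IsArcDeformation.eq_of_isFactorization (hI : IsNilpotent I)
    {ψ ψ' : ArcRing (D.ciIdeal k) →ₐ[k] B} (hψ : D.IsArcDeformation hn I φ ψ)
    (hψ' : D.IsArcDeformation hn I φ ψ') {p : D.ModelVars n → B} (hp : ∀ q, p q ∈ I)
    {U U' : Fin d → B⟦X⟧ˣ} (h : D.IsFactorization ψ p U) (h' : D.IsFactorization ψ' p U') :
    ψ = ψ' := by
  have hU : U = U' := by
    funext j
    apply Units.ext
    apply ((D.isDistinguished_modelSeries hp (Sum.inl j)).bijective hI).injective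
    have h1 := hψ.shift_arcCoord j
    have h2 := hψ'.shift_arcCoord j
    rw [h, torusEval_gen_inl] at h1
    rw [h', torusEval_gen_inl] at h2
    exact h1.trans h2.symm
  apply arcRing_algHom_ext
  intro q
  rw [← coeff_arcCoord, ← coeff_arcCoord, h, h', hU]

/-- Converse construction: the units `U_j` are found by solving for the prescribed coefficients, and
the remaining unit parts are defined as characters of `U`, so that the unit equations hold
automatically. -/
theorem exists_isArcDeformation (hn : (1 : ℝ) ⊗ₜ[ℤ] n ∈ D.cone) (hI : IsNilpotent I)
    (φ : D.BaseField k n →ₐ[k] B) {p : D.ModelVars n → B} (hp : ∀ q, p q ∈ I)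
    (hpM : D.IsModelPoint p) :
    ∃ ψ : ArcRing (D.ciIdeal k) →ₐ[k] B, D.IsArcDeformation hn I φ ψ ∧
      ∃ U, D.IsFactorization ψ p U := by
  have hP := D.isDistinguished_modelSeries hp
  have hφ : ∀ i, IsUnit (φ (D.baseVar k n ⟨(i, D.height n (Sum.inl i)), le_rfl⟩)) :=
    fun i => (D.baseVar_ne_zero k _).isUnit.map φ
  have hU : ∀ j, ∃ U : B⟦X⟧ˣ, shift (D.height n (Sum.inl j))
      (D.modelSeries p (Sum.inl j) * (U : B⟦X⟧)) = D.tail (fun p => φ (D.baseVar k n p)) j := by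
    intro j
    obtain ⟨U, hU⟩ := ((hP (Sum.inl j)).bijective hI).surjective
      (D.tail (fun p => φ (D.baseVar k n p)) j)
    simp only at hU
    have h0 := (hP (Sum.inl j)).coeff_shift_mul_sub_mem U 0
    rw [hU, map_sub, coeff_zero_eq_constantCoeff_apply, coeff_zero_eq_constantCoeff_apply] at h0
    have hu : IsUnit U := isUnit_iff_constantCoeff.mpr
      (isUnit_of_sub_mem hI (isUnit_iff_constantCoeff.mp (D.isUnit_tail hφ j)) h0)
    exact ⟨hu.unit, hU⟩
  choose U hU using hU
  have hZ : D.ciIdeal k ≤ RingHom.ker (MvPolynomial.aeval (R := k)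
      fun i => D.modelSeries p i * (↑(D.torusEval U (D.gen i)) : B⟦X⟧)) := by
    refine Ideal.span_le.mpr ?_
    rintro _ ⟨q, rfl⟩
    show MvPolynomial.aeval _ _ = 0
    rw [aeval_binomial, sub_eq_zero]
    simp only [mul_pow, Finset.prod_mul_distrib, hpM q]
    congr 1
    have h1 := (D.prod_pow_toNat_ell_eq_iff q fun i => D.torusEval U (D.gen i)).mpr (by
      simp only [torusEval_gen_inl])
    simpa using congrArg Units.val h1
  let ψ : ArcRing (D.ciIdeal k) →ₐ[k] B := arcLift _ _ hZ
  have hfac : D.IsFactorization ψ p U := by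
    intro i
    ext s
    simp [ψ]
  have hbase : ∀ p : D.BaseVars n,
      ψ (Ideal.Quotient.mk _ (MvPolynomial.X (Sum.inl p.1.1, p.1.2))) = φ (D.baseVar k n p) := by
    rintro ⟨⟨j, s⟩, hs⟩
    simp only at hs
    have h1 := congrArg (coeff (s - D.height n (Sum.inl j))) (hU j)
    rw [coeff_shift, coeff_tail] at h1
    simp only [Nat.sub_add_cancel hs] at h1
    rw [← h1, ← coeff_arcCoord, hfac, torusEval_gen_inl]
  refine ⟨ψ, ⟨?_, hbase⟩, U, hfac⟩
  -- Modulo `I`, the distinguished factor becomes `X ^ ⟨n, m_i⟩`, so shifting recovers `U_j` itself,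
  -- equal to the generic unit.
  have hcomp : (Ideal.Quotient.mkₐ k I).comp ψ =
      ((Ideal.Quotient.mkₐ k I).comp φ).comp (D.ciGenericArc k hn) := by
    have hPm : ∀ i, PowerSeries.map (Ideal.Quotient.mk I) (D.modelSeries p i) =
        X ^ D.height n i := by
      intro i
      rw [← sub_eq_zero]
      ext s
      have := (hP i).coeff_sub_mem s
      rw [← Ideal.Quotient.eq_zero_iff_mem] at this
      simpa [coeff_X_pow, apply_ite] using this
    have hUm : ∀ j, Units.map (PowerSeries.map (Ideal.Quotient.mk I) : B⟦X⟧ →* (B ⧸ I)⟦X⟧) (U j) =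
        Units.map (PowerSeries.map ((Ideal.Quotient.mk I).comp (φ : D.BaseField k n →+* B)) :
          (D.BaseField k n)⟦X⟧ →* (B ⧸ I)⟦X⟧) (D.genericUnit k n j) := by
      intro j
      apply Units.ext
      have h1 := congrArg (PowerSeries.map (Ideal.Quotient.mk I)) (hU j)
      rw [map_shift, map_mul, hPm, shift_X_pow_mul, map_tail] at h1
      refine h1.trans ?_
      exact (D.map_tail ((Ideal.Quotient.mk I).comp (φ : D.BaseField k n →+* B)) _ j).symm
    apply arcRing_algHom_ext
    rintro ⟨i, s⟩
    have h1 : (Ideal.Quotient.mkₐ k I).comp ψ (Ideal.Quotient.mk _ (MvPolynomial.X (i, s))) =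
        coeff s (PowerSeries.map (Ideal.Quotient.mk I) (arcCoord ψ i)) := by
      simp
    have h2 : ((Ideal.Quotient.mkₐ k I).comp φ).comp (D.ciGenericArc k hn)
        (Ideal.Quotient.mk _ (MvPolynomial.X (i, s))) =
        coeff s (PowerSeries.map ((Ideal.Quotient.mk I).comp (φ : D.BaseField k n →+* B))
          (X ^ D.height n i *
            (↑(D.torusEval (D.genericUnit k n) (D.gen i)) : (D.BaseField k n)⟦X⟧))) := by
      rw [AlgHom.comp_apply, ciGenericArc_mk_X, coeff_map]
      rfl
    rw [h1, h2, hfac, RingHom.map_mul, RingHom.map_mul, hPm, RingHom.map_pow, map_X]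
    congr 2
    have h3 := D.map_torusEval
      (Units.map (PowerSeries.map (Ideal.Quotient.mk I) : B⟦X⟧ →* (B ⧸ I)⟦X⟧)) U (D.gen i)
    have h4 := D.map_torusEval
      (Units.map (PowerSeries.map ((Ideal.Quotient.mk I).comp (φ : D.BaseField k n →+* B)) :
          (D.BaseField k n)⟦X⟧ →* (B ⧸ I)⟦X⟧)) (D.genericUnit k n) (D.gen i)
    exact congrArg Units.val (h3.trans ((congrArg (D.torusEval · (D.gen i)) (funext hUm)).trans
      h4.symm))
  intro x
  rw [← Ideal.Quotient.eq]
  exact DFunLike.congr_fun hcomp x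

end Deformation

end AffineToricData

theorem map_quotient_mk_pow {R : Type*} [CommRing R] (I : Ideal R) (e : ℕ) :
    (I.map (Ideal.Quotient.mk (I ^ e))) ^ e = ⊥ := by
  rw [← Ideal.map_pow, Ideal.map_quotient_self]

namespace AffineToricData

variable {N : Type*} [AddCommGroup N] {d c : ℕ} {D : AffineToricData N d c} {n : N}

/-! ### Comparison of the truncations -/

section Comparison

variable {k : Type*} [Field k] {hn : (1 : ℝ) ⊗ₜ[ℤ] n ∈ D.cone}
  {O : Type*} [CommRing O] [Algebra k O] {T : Type*} [CommRing T] [Algebra k T]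
  {𝔪 : Ideal O} {J : Ideal T} {φO : D.BaseField k n →ₐ[k] O} {φT : D.BaseField k n →ₐ[k] T}
  {ψO : ArcRing (D.ciIdeal k) →ₐ[k] O} {x : D.ModelVars n → T}

/-- A Yoneda argument: `O` classifies deformations of the generic arc, `T` classifies points of the
model. The factorization of the tautological deformation gives a map from `T`, and the deformation
built from the tautological point `x` gives a map from `O`. -/
theorem exists_truncation_equiv (hψO : D.IsArcDeformation hn 𝔪 φO ψO)
    (hJ : J = Ideal.span (Set.range x)) (hx : D.IsModelPoint x) (e : ℕ)
    (hO : ∀ ψ : ArcRing (D.ciIdeal k) →ₐ[k] T ⧸ J ^ e,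
      D.IsArcDeformation hn (J.map (Ideal.Quotient.mk (J ^ e)))
        ((Ideal.Quotient.mkₐ k (J ^ e)).comp φT) ψ →
      ∃ γ : O →ₐ[k] T ⧸ J ^ e, γ.comp ψO = ψ ∧
        γ.comp φO = (Ideal.Quotient.mkₐ k (J ^ e)).comp φT ∧
        𝔪 ≤ (J.map (Ideal.Quotient.mk (J ^ e))).comap γ)
    (hOext : ∀ γ γ' : O →ₐ[k] O ⧸ 𝔪 ^ e, γ.comp ψO = γ'.comp ψO → γ = γ')
    (hT : ∀ p : D.ModelVars n → O ⧸ 𝔪 ^ e, (∀ q, p q ∈ 𝔪.map (Ideal.Quotient.mk (𝔪 ^ e))) →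
      D.IsModelPoint p → ∃ ρ : T →ₐ[k] O ⧸ 𝔪 ^ e,
        ρ.comp φT = (Ideal.Quotient.mkₐ k (𝔪 ^ e)).comp φO ∧ (∀ q, ρ (x q) = p q) ∧
        J ^ e ≤ RingHom.ker ρ)
    (hText : ∀ ρ ρ' : T →ₐ[k] T ⧸ J ^ e, J ^ e ≤ RingHom.ker ρ → J ^ e ≤ RingHom.ker ρ' →
      ρ.comp φT = ρ'.comp φT → (∀ q, ρ (x q) = ρ' (x q)) → ρ = ρ') :
    ∃ (θ : (O ⧸ 𝔪 ^ e) ≃ₐ[k] (T ⧸ J ^ e)) (ψ : ArcRing (D.ciIdeal k) →ₐ[k] T ⧸ J ^ e),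
      D.IsArcDeformation hn (J.map (Ideal.Quotient.mk (J ^ e)))
        ((Ideal.Quotient.mkₐ k (J ^ e)).comp φT) ψ ∧
      (∃ U, D.IsFactorization ψ (fun q => Ideal.Quotient.mk (J ^ e) (x q)) U) ∧
      (∀ y, θ (Ideal.Quotient.mk _ (ψO y)) = ψ y) ∧
      ∀ a, θ (Ideal.Quotient.mk _ (φO a)) = Ideal.Quotient.mk _ (φT a) := by
  have hnilO : IsNilpotent (𝔪.map (Ideal.Quotient.mk (𝔪 ^ e))) := ⟨e, map_quotient_mk_pow 𝔪 e⟩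
  have hnilT : IsNilpotent (J.map (Ideal.Quotient.mk (J ^ e))) := ⟨e, map_quotient_mk_pow J e⟩
  have hxJ : ∀ q, x q ∈ J := fun q => hJ ▸ Ideal.subset_span ⟨q, rfl⟩
  have hψe := hψO.map (Ideal.Quotient.mkₐ k (𝔪 ^ e))
    (J := 𝔪.map (Ideal.Quotient.mk (𝔪 ^ e))) Ideal.le_comap_map
  obtain ⟨p, hpI, hpM, U, hfac⟩ := hψe.exists_isFactorization hnilO
  obtain ⟨ρ, hρφ, hρx, hρJ⟩ := hT p hpI hpM
  let G : (T ⧸ J ^ e) →ₐ[k] (O ⧸ 𝔪 ^ e) := Ideal.Quotient.liftₐ (J ^ e) ρ hρJ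
  have hG : ∀ t, G (Ideal.Quotient.mk _ t) = ρ t := fun t => rfl
  have hGI : J.map (Ideal.Quotient.mk (J ^ e)) ≤ (𝔪.map (Ideal.Quotient.mk (𝔪 ^ e))).comap G := by
    refine Ideal.map_le_iff_le_comap.mpr (hJ.le.trans (Ideal.span_le.mpr ?_))
    rintro _ ⟨q, rfl⟩
    show G (Ideal.Quotient.mk _ (x q)) ∈ 𝔪.map (Ideal.Quotient.mk (𝔪 ^ e))
    rw [hG, hρx]
    exact hpI q
  have hxI : ∀ q, Ideal.Quotient.mk (J ^ e) (x q) ∈ J.map (Ideal.Quotient.mk (J ^ e)) :=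
    fun q => Ideal.mem_map_of_mem _ (hxJ q)
  obtain ⟨ψ, hψ, UT, hfacT⟩ := exists_isArcDeformation hn hnilT
    ((Ideal.Quotient.mkₐ k (J ^ e)).comp φT) hxI (hx.map (Ideal.Quotient.mk (J ^ e)))
  obtain ⟨γ, hγψ, hγφ, hγ𝔪⟩ := hO ψ hψ
  have hγker : ∀ y ∈ 𝔪 ^ e, γ y = 0 := by
    intro y hy
    have h1 := Ideal.mem_map_of_mem γ hy
    rw [Ideal.map_pow] at h1
    have h2 := Ideal.pow_right_mono (Ideal.map_le_iff_le_comap.mpr hγ𝔪) e h1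
    rwa [map_quotient_mk_pow] at h2
  let F : (O ⧸ 𝔪 ^ e) →ₐ[k] (T ⧸ J ^ e) := Ideal.Quotient.liftₐ (𝔪 ^ e) γ hγker
  have hF : ∀ y, F (Ideal.Quotient.mk _ y) = γ y := fun y => rfl
  have hFI : 𝔪.map (Ideal.Quotient.mk (𝔪 ^ e)) ≤ (J.map (Ideal.Quotient.mk (J ^ e))).comap F :=
    Ideal.map_le_iff_le_comap.mpr hγ𝔪
  have hFψ : F.comp ((Ideal.Quotient.mkₐ k (𝔪 ^ e)).comp ψO) = ψ := hγψ
  -- This composite fixes `x` by uniqueness of the Weierstrass factorization.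
  have hFG : F.comp G = AlgHom.id k _ := by
    have h1 : F.comp ρ = Ideal.Quotient.mkₐ k (J ^ e) := by
      refine hText _ _ (fun t ht => ?_) (fun t ht => Ideal.Quotient.eq_zero_iff_mem.mpr ht) ?_ ?_
      · rw [RingHom.mem_ker, AlgHom.comp_apply, RingHom.mem_ker.mp (hρJ ht), map_zero]
      · rw [AlgHom.comp_assoc, hρφ, ← hγφ]
        rfl
      · intro q
        rw [AlgHom.comp_apply, hρx]
        have h2 := hfac.map F
        rw [hFψ] at h2
        exact congrFun (h2.unique hnilT (fun q => hFI (hpI q)) hxI hfacT) q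
    refine AlgHom.ext fun t => ?_
    obtain ⟨t, rfl⟩ := Ideal.Quotient.mk_surjective t
    exact DFunLike.congr_fun h1 t
  -- This composite fixes the tautological arc, because a deformation is determined by its model
  -- point.
  have hGF : G.comp F = AlgHom.id k _ := by
    have h1 : G.comp γ = Ideal.Quotient.mkₐ k (𝔪 ^ e) := by
      refine hOext _ _ ?_
      rw [AlgHom.comp_assoc, hγψ]
      have h2 := hψ.map G hGI
      have h3 : G.comp ((Ideal.Quotient.mkₐ k (J ^ e)).comp φT) =
          (Ideal.Quotient.mkₐ k (𝔪 ^ e)).comp φO := hρφ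
      rw [h3] at h2
      have h4 := hfacT.map G
      have h5 : (fun q => G (Ideal.Quotient.mk (J ^ e) (x q))) = p := funext hρx
      rw [h5] at h4
      exact h2.eq_of_isFactorization hnilO hψe hpI h4 hfac
    refine AlgHom.ext fun t => ?_
    obtain ⟨t, rfl⟩ := Ideal.Quotient.mk_surjective t
    exact DFunLike.congr_fun h1 t
  exact ⟨AlgEquiv.ofAlgHom F G hFG hGF, ψ, hψ, ⟨UT, hfacT⟩, fun y => DFunLike.congr_fun hγψ y,
    fun a => DFunLike.congr_fun hγφ a⟩

theorem formalIsoOver_of_isArcDeformation (hψO : D.IsArcDeformation hn 𝔪 φO ψO)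
    (hJ : J = Ideal.span (Set.range x)) (hx : D.IsModelPoint x)
    (hO : ∀ e, ∀ ψ : ArcRing (D.ciIdeal k) →ₐ[k] T ⧸ J ^ e,
      D.IsArcDeformation hn (J.map (Ideal.Quotient.mk (J ^ e)))
        ((Ideal.Quotient.mkₐ k (J ^ e)).comp φT) ψ →
      ∃ γ : O →ₐ[k] T ⧸ J ^ e, γ.comp ψO = ψ ∧
        γ.comp φO = (Ideal.Quotient.mkₐ k (J ^ e)).comp φT ∧
        𝔪 ≤ (J.map (Ideal.Quotient.mk (J ^ e))).comap γ)
    (hOext : ∀ e, ∀ γ γ' : O →ₐ[k] O ⧸ 𝔪 ^ e, γ.comp ψO = γ'.comp ψO → γ = γ')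
    (hOext' : ∀ e, ∀ γ γ' : O →ₐ[k] T ⧸ J ^ e, γ.comp ψO = γ'.comp ψO → γ = γ')
    (hT : ∀ e, ∀ p : D.ModelVars n → O ⧸ 𝔪 ^ e,
      (∀ q, p q ∈ 𝔪.map (Ideal.Quotient.mk (𝔪 ^ e))) →
      D.IsModelPoint p → ∃ ρ : T →ₐ[k] O ⧸ 𝔪 ^ e,
        ρ.comp φT = (Ideal.Quotient.mkₐ k (𝔪 ^ e)).comp φO ∧ (∀ q, ρ (x q) = p q) ∧
        J ^ e ≤ RingHom.ker ρ)
    (hText : ∀ e, ∀ ρ ρ' : T →ₐ[k] T ⧸ J ^ e, J ^ e ≤ RingHom.ker ρ → J ^ e ≤ RingHom.ker ρ' →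
      ρ.comp φT = ρ'.comp φT → (∀ q, ρ (x q) = ρ' (x q)) → ρ = ρ') :
    FormalIsoOver (φO : D.BaseField k n →+* O) 𝔪 (φT : D.BaseField k n →+* T) J := by
  choose θ ψ hψ hfac hθψ hθφ using fun e =>
    exists_truncation_equiv hψO hJ hx e (hO e) (hOext e) (hT e) (hText e)
  refine formalIsoOver_of_quotientEquiv _ _ _ _ (fun e => (θ e).toRingEquiv) ?_
    fun e a => hθφ e a
  intro l e hle y
  have hxI : ∀ q, Ideal.Quotient.mk (J ^ l) (x q) ∈ J.map (Ideal.Quotient.mk (J ^ l)) :=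
    fun q => Ideal.mem_map_of_mem _ (hJ ▸ Ideal.subset_span ⟨q, rfl⟩)
  let tr : (T ⧸ J ^ e) →ₐ[k] (T ⧸ J ^ l) := Ideal.Quotient.factorₐ k (Ideal.pow_le_pow_right hle)
  have htrI : J.map (Ideal.Quotient.mk (J ^ e)) ≤
      (J.map (Ideal.Quotient.mk (J ^ l))).comap tr := by
    rw [Ideal.map_le_iff_le_comap]
    exact fun t ht => Ideal.mem_map_of_mem (Ideal.Quotient.mk (J ^ l)) ht
  -- Both arcs have the image of `x` as model point, so they coincide. This makes the isomorphisms
  -- compatible with truncation.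
  have h1 : tr.comp (ψ e) = ψ l := by
    obtain ⟨U, hU⟩ := hfac e
    obtain ⟨U', hU'⟩ := hfac l
    exact ((hψ e).map tr htrI).eq_of_isFactorization ⟨l, map_quotient_mk_pow J l⟩ (hψ l) hxI
      (hU.map tr) hU'
  have h2 := hOext' l (tr.comp ((θ e).toAlgHom.comp (Ideal.Quotient.mkₐ k (𝔪 ^ e))))
    ((θ l).toAlgHom.comp (Ideal.Quotient.mkₐ k (𝔪 ^ l))) (AlgHom.ext fun z =>
      (congrArg tr (hθψ e z)).trans ((DFunLike.congr_fun h1 z).trans (hθψ l z).symm))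
  exact DFunLike.congr_fun h2 y

end Comparison

/-! ### The local ring at the generic point of the Nash set -/

section Local

variable {k : Type*} [Field k] (hn : (1 : ℝ) ⊗ₜ[ℤ] n ∈ D.cone)

variable (D k) in
/-- The local ring of the arc scheme of `W` at the generic point of the Nash set. -/
abbrev NashLocalRing : Type _ := Localization.AtPrime (D.toCI k (D.nashPoint k hn)).asIdeal

theorem mem_toCI_nashPoint {y : ArcRing (D.ciIdeal k)} :
    y ∈ (D.toCI k (D.nashPoint k hn)).asIdeal ↔ D.ciGenericArc k hn y = 0 :=
  Iff.rfl

theorem ciGenericArc_ne_zero (y : (D.toCI k (D.nashPoint k hn)).asIdeal.primeCompl) :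
    D.ciGenericArc k hn y ≠ 0 :=
  fun h => y.2 ((mem_toCI_nashPoint hn).mpr h)

variable (D k) in
/-- The canonical morphism to the local ring. -/
def toNashLocalRing : ArcRing (D.ciIdeal k) →ₐ[k] D.NashLocalRing k hn :=
  IsScalarTower.toAlgHom k _ _

theorem isUnit_toNashLocalRing {y : ArcRing (D.ciIdeal k)} (hy : D.ciGenericArc k hn y ≠ 0) :
    IsUnit (D.toNashLocalRing k hn y) :=
  IsLocalization.map_units (M := (D.toCI k (D.nashPoint k hn)).asIdeal.primeCompl) _
    ⟨y, fun h => hy ((mem_toCI_nashPoint hn).mp h)⟩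

theorem nashLocalRing_algHom_ext {B : Type*} [CommRing B] [Algebra k B]
    {γ γ' : D.NashLocalRing k hn →ₐ[k] B}
    (h : γ.comp (D.toNashLocalRing k hn) = γ'.comp (D.toNashLocalRing k hn)) : γ = γ' := by
  apply AlgHom.coe_ringHom_injective
  apply IsLocalization.ringHom_ext (D.toCI k (D.nashPoint k hn)).asIdeal.primeCompl
  exact RingHom.ext fun y => DFunLike.congr_fun h y

theorem baseField_algHom_ext {B : Type*} [CommRing B] [Algebra k B]
    {γ γ' : D.BaseField k n →ₐ[k] B} (h : ∀ p, γ (D.baseVar k n p) = γ' (D.baseVar k n p)) :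
    γ = γ' := by
  apply AlgHom.coe_ringHom_injective
  apply IsLocalization.ringHom_ext (nonZeroDivisors (MvPolynomial (D.BaseVars n) k))
  have h1 : γ.comp (IsScalarTower.toAlgHom k (MvPolynomial (D.BaseVars n) k) (D.BaseField k n)) =
      γ'.comp (IsScalarTower.toAlgHom k (MvPolynomial (D.BaseVars n) k) (D.BaseField k n)) :=
    MvPolynomial.algHom_ext h
  exact RingHom.ext fun y => DFunLike.congr_fun h1 y

theorem exists_nashLocalRing_lift {B : Type*} [CommRing B] [Algebra k B]
    (ψ : ArcRing (D.ciIdeal k) →ₐ[k] B)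
    (hψ : ∀ y, D.ciGenericArc k hn y ≠ 0 → IsUnit (ψ y)) :
    ∃ γ : D.NashLocalRing k hn →ₐ[k] B, γ.comp (D.toNashLocalRing k hn) = ψ := by
  refine ⟨IsLocalization.liftAlgHom
    (M := (D.toCI k (D.nashPoint k hn)).asIdeal.primeCompl) (f := ψ)
    fun y => hψ _ (ciGenericArc_ne_zero hn y), AlgHom.ext fun y => ?_⟩
  exact IsLocalization.lift_eq _ _

/-- The generic arc sends a nonzero polynomial in the base variables to a nonzero element of `K`, so
that polynomial is invertible in the local ring. -/
theorem exists_baseField_lift :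
    ∃ φ : D.BaseField k n →ₐ[k] D.NashLocalRing k hn, ∀ p : D.BaseVars n,
      φ (D.baseVar k n p) = D.toNashLocalRing k hn
        (Ideal.Quotient.mk _ (MvPolynomial.X (Sum.inl p.1.1, p.1.2))) := by
  let z : MvPolynomial (D.BaseVars n) k →ₐ[k] ArcRing (D.ciIdeal k) :=
    MvPolynomial.aeval fun p => Ideal.Quotient.mk _ (MvPolynomial.X (Sum.inl p.1.1, p.1.2))
  have hz : ∀ F, D.ciGenericArc k hn (z F) = algebraMap _ (D.BaseField k n) F := by
    intro F
    rw [← aeval_baseVar, ← AlgHom.comp_apply]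
    congr 1
    apply MvPolynomial.algHom_ext
    intro p
    simp [z, ciGenericArc_baseVar]
  refine ⟨IsLocalization.liftAlgHom (M := nonZeroDivisors (MvPolynomial (D.BaseVars n) k))
    (f := (D.toNashLocalRing k hn).comp z) fun F => isUnit_toNashLocalRing hn ?_, fun p => ?_⟩
  · show D.ciGenericArc k hn (z F) ≠ 0
    rw [hz, Ne, FaithfulSMul.algebraMap_eq_zero_iff]
    exact nonZeroDivisors.ne_zero F.2
  · refine (IsLocalization.lift_eq _ _).trans ?_
    simp [z]

/-- Elements outside the prime ideal are nonzero on the generic arc, so their images are units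
modulo the nilpotent ideal `I`, hence units. -/
theorem exists_nashLocalRing_lift_of_isArcDeformation {B : Type*} [CommRing B] [Algebra k B]
    {I : Ideal B} (hI : IsNilpotent I) {φO : D.BaseField k n →ₐ[k] D.NashLocalRing k hn}
    (hφO : ∀ p : D.BaseVars n, φO (D.baseVar k n p) = D.toNashLocalRing k hn
      (Ideal.Quotient.mk _ (MvPolynomial.X (Sum.inl p.1.1, p.1.2))))
    {φ : D.BaseField k n →ₐ[k] B} {ψ : ArcRing (D.ciIdeal k) →ₐ[k] B}
    (hψ : D.IsArcDeformation hn I φ ψ) :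
    ∃ γ : D.NashLocalRing k hn →ₐ[k] B, γ.comp (D.toNashLocalRing k hn) = ψ ∧ γ.comp φO = φ ∧
      IsLocalRing.maximalIdeal (D.NashLocalRing k hn) ≤ I.comap γ := by
  obtain ⟨γ, hγ⟩ := exists_nashLocalRing_lift hn ψ fun y hy =>
    isUnit_of_sub_mem hI (hy.isUnit.map φ) (hψ.sub_mem y)
  refine ⟨γ, hγ, baseField_algHom_ext fun p => ?_, ?_⟩
  · rw [AlgHom.comp_apply, hφO, ← hψ.apply_baseVar, ← hγ]
    rfl
  · rw [← IsLocalization.AtPrime.map_eq_maximalIdeal (D.toCI k (D.nashPoint k hn)).asIdeal,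
      Ideal.map_le_iff_le_comap]
    intro y hy
    have h1 := hψ.sub_mem y
    rw [(mem_toCI_nashPoint hn).mp hy, map_zero, sub_zero, ← hγ] at h1
    exact h1

/-- The generic arc extends to a retraction `ρ` of `φ`. It kills `y - φ (ρ y)`, which therefore
cannot be a unit. -/
theorem exists_residue_section {φ : D.BaseField k n →ₐ[k] D.NashLocalRing k hn}
    (hφ : ∀ p : D.BaseVars n, φ (D.baseVar k n p) = D.toNashLocalRing k hn
      (Ideal.Quotient.mk _ (MvPolynomial.X (Sum.inl p.1.1, p.1.2)))) :
    ∃ ρ : D.NashLocalRing k hn →ₐ[k] D.BaseField k n,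
      ρ.comp (D.toNashLocalRing k hn) = D.ciGenericArc k hn ∧
      ∀ y, y - φ (ρ y) ∈ IsLocalRing.maximalIdeal (D.NashLocalRing k hn) := by
  obtain ⟨ρ, hρ⟩ := exists_nashLocalRing_lift hn (D.ciGenericArc k hn) fun y hy => hy.isUnit
  have hρφ : ρ.comp φ = AlgHom.id k _ := by
    refine baseField_algHom_ext fun p => ?_
    rw [AlgHom.comp_apply, hφ, ← AlgHom.comp_apply, hρ, ciGenericArc_baseVar, AlgHom.id_apply]
  refine ⟨ρ, hρ, fun y => ?_⟩
  rw [IsLocalRing.mem_maximalIdeal]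
  intro hu
  refine (hu.map ρ).ne_zero ?_
  rw [map_sub, ← AlgHom.comp_apply, hρφ, AlgHom.id_apply, sub_self]

theorem isArcDeformation_toNashLocalRing {φ : D.BaseField k n →ₐ[k] D.NashLocalRing k hn}
    (hφ : ∀ p : D.BaseVars n, φ (D.baseVar k n p) = D.toNashLocalRing k hn
      (Ideal.Quotient.mk _ (MvPolynomial.X (Sum.inl p.1.1, p.1.2)))) :
    D.IsArcDeformation (B := D.NashLocalRing k hn) hn
      (IsLocalRing.maximalIdeal (D.NashLocalRing k hn)) φ
      (D.toNashLocalRing k hn) where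
  sub_mem y := by
    obtain ⟨ρ, hρ, hmem⟩ := exists_residue_section hn hφ
    rw [← hρ]
    exact hmem _
  apply_baseVar p := (hφ p).symm

theorem bijective_residue {φ : D.BaseField k n →ₐ[k] D.NashLocalRing k hn}
    (hφ : ∀ p : D.BaseVars n, φ (D.baseVar k n p) = D.toNashLocalRing k hn
      (Ideal.Quotient.mk _ (MvPolynomial.X (Sum.inl p.1.1, p.1.2)))) :
    Function.Bijective fun a => IsLocalRing.residue (D.NashLocalRing k hn) (φ a) := by
  refine ⟨((IsLocalRing.residue (D.NashLocalRing k hn)).comp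
    (φ : D.BaseField k n →+* _)).injective, fun y => ?_⟩
  obtain ⟨y, rfl⟩ := IsLocalRing.residue_surjective y
  obtain ⟨ρ, -, hmem⟩ := exists_residue_section hn hφ
  refine ⟨ρ y, ?_⟩
  have := (IsLocalRing.residue_eq_zero_iff (R := D.NashLocalRing k hn) _).mpr (hmem y)
  rw [map_sub, sub_eq_zero] at this
  exact this.symm

theorem formalIsoOver_nashLocalRing {φ : D.BaseField k n →ₐ[k] D.NashLocalRing k hn}
    (hφ : ∀ p : D.BaseVars n, φ (D.baseVar k n p) = D.toNashLocalRing k hn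
      (Ideal.Quotient.mk _ (MvPolynomial.X (Sum.inl p.1.1, p.1.2)))) :
    FormalIsoOver (R := D.NashLocalRing k hn) (φ : D.BaseField k n →+* D.NashLocalRing k hn)
      (IsLocalRing.maximalIdeal (D.NashLocalRing k hn))
      (algebraMap (D.BaseField k n)
        (D.BaseField k n ⊗[k] D.FormalModel k n (Set.range D.ell)))
      (D.baseChangeIdeal k n (Set.range D.ell) (D.BaseField k n)) := by
  refine formalIsoOver_of_isArcDeformation
    (φT := IsScalarTower.toAlgHom k (D.BaseField k n)
      (D.BaseField k n ⊗[k] D.FormalModel k n (Set.range D.ell)))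
    (isArcDeformation_toNashLocalRing hn hφ) D.baseChangeIdeal_eq_span
    (D.isModelPoint_formalX n k (D.BaseField k n)) ?_ ?_ ?_ ?_ ?_
  · intro e ψ hψ
    exact exists_nashLocalRing_lift_of_isArcDeformation hn ⟨e, map_quotient_mk_pow _ e⟩ hφ hψ
  · exact fun e γ γ' h => nashLocalRing_algHom_ext hn h
  · exact fun e γ γ' h => nashLocalRing_algHom_ext hn h
  · intro e p hpI hp
    obtain ⟨ρ, h1, h2, h3⟩ := D.exists_formalLift (map_quotient_mk_pow _ e)
      ((Ideal.Quotient.mkₐ k _).comp φ) hpI hp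
    exact ⟨ρ, AlgHom.ext h1, h2, h3⟩
  · intro e ρ ρ' h1 h2 h3 h4
    apply AlgHom.coe_ringHom_injective
    exact D.formal_ringHom_ext h1 h2 (fun a => DFunLike.congr_fun h3 a) h4

end Local

end AffineToricData

end ToricArc

end

theorem mainTheorem5 {k : Type*} [Field k] [CharZero k]
    {N : Type*} [AddCommGroup N] [Module.Free ℤ N] [Module.Finite ℤ N] {d c : ℕ}
    (D : ToricArc.AffineToricData N d c) (n : N) (hn : (1 : ℝ) ⊗ₜ[ℤ] n ∈ D.cone) :
    ∃ η : PrimeSpectrum (ToricArc.ArcRing (D.toricIdeal k)),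
      IsGenericPoint η (D.nashSet k n) ∧
      ∃ φ : D.BaseField k n →ₐ[k] Localization.AtPrime (D.toCI k η).asIdeal,
        (∀ p : D.BaseVars n,
          φ (algebraMap (MvPolynomial (D.BaseVars n) k) (D.BaseField k n) (MvPolynomial.X p)) =
            algebraMap (ToricArc.ArcRing (D.ciIdeal k))
              (Localization.AtPrime (D.toCI k η).asIdeal)
              (Ideal.Quotient.mk (ToricArc.arcIdeal (D.ciIdeal k))
                (MvPolynomial.X (Sum.inl p.1.1, p.1.2)))) ∧
        Function.Bijective
          (fun a : D.BaseField k n =>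
            IsLocalRing.residue (Localization.AtPrime (D.toCI k η).asIdeal) (φ a)) ∧
        ToricArc.FormalIsoOver (R := Localization.AtPrime (D.toCI k η).asIdeal)
          (φ : D.BaseField k n →+* Localization.AtPrime (D.toCI k η).asIdeal)
          (IsLocalRing.maximalIdeal (Localization.AtPrime (D.toCI k η).asIdeal))
          (algebraMap (D.BaseField k n)
            (D.BaseField k n ⊗[k] D.FormalModel k n (Set.range D.ell)))
          (D.baseChangeIdeal k n (Set.range D.ell) (D.BaseField k n)) := by
  obtain ⟨φ, hφ⟩ := ToricArc.AffineToricData.exists_baseField_lift (k := k) hn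
  exact ⟨D.nashPoint k hn, D.isGenericPoint_nashPoint k hn, φ, hφ,
    ToricArc.AffineToricData.bijective_residue hn hφ,
    ToricArc.AffineToricData.formalIsoOver_nashLocalRing hn hφ⟩
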